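/- Let $k$ be an algebraically closed field of characteristic $0$, let $n\ge 3$ be an odd integer, and let $q\in k$ be a primitive $n$-th root of unity. Let $U_q(\mathfrak{sl}_2)$ be the Hopf algebra over $k$ generated by $E,F,K,K^{-1}$ with relations $KK^{-1}=K^{-1}K=1$, $KE=q^2EK$, $KF=q^{-2}FK$, $EF-FE=\frac{K-K^{-1}}{q-q^{-1}}$ and coproduct $\Delta(K^{\pm1})=K^{\pm1}\otimes K^{\pm1}$, $\Delta(E)=1\otimes E+E\otimes K$, $\Delta(F)=K^{-1}\otimes F+F\otimes 1$, and let $u_q(\mathfrak{sl}_2)$ be its quotient Hopf algebra by the two-sided ideal generated by $K^n-1,E^n,F^n$; it is finite-dimensional, so that its dual $u_q(\mathfrak{sl}_2)^*$ is a Hopf algebra with the transposed structure maps. Let $\mathcal O_q(SL_2)$ be the Hopf algebra over $k$ generated by $a,b,c,d$ with relations $ba=qab$, $ca=qac$, $db=qbd$, $dc=qcd$, $bc=cb$, $ad=q^{-1}bc+1$, $da=qbc+1$, with $\Delta(a)=a\otimes a+b\otimes c$, $\Delta(b)=a\otimes b+b\otimes d$, $\Delta(c)=c\otimes a+d\otimes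 c$, $\Delta(d)=c\otimes b+d\otimes d$, $\epsilon(a)=\epsilon(d)=1$, $\epsilon(b)=\epsilon(c)=0$, $S(a)=d$, $S(b)=-qb$, $S(c)=-q^{-1}c$, $S(d)=a$. Let $\pi:\mathcal O_q(SL_2)\to\overline{\mathcal O_q(SL_2)}$ be its quotient Hopf algebra by the two-sided ideal generated by $a^n-1,b^n,c^n,d^n-1$. Let $\rho:U_q(\mathfrak{sl}_2)\to M_2(k)$ be the representation $\rho(E)=\begin{pmatrix}0&1\\0&0\end{pmatrix}$, $\rho(F)=\begin{pmatrix}0&0\\1&0\end{pmatrix}$, $\rho(K)=\begin{pmatrix}q&0\\0&q^{-1}\end{pmatrix}$, write $\rho(x)=\begin{pmatrix}A(x)&B(x)\\C(x)&D(x)\end{pmatrix}$, and let $\phi:\mathcal O_q(SL_2)\to U_q(\mathfrak{sl}_2)^*$ be the algebra map (for the convolution product $(fg)(x)=\sum f(x_{(1)})g(x_{(2)})$) with $\phi(a)=A$, $\phi(b)=B$, $\phi(c)=C$, $\phi(d)=D$. The image of $\phi$ lies in $u_q(\mathfrak{sl}_2)^*$, and $\phi$ induces a Hopf algebra map $\overline\phi:\overline{\mathcal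 O_q(SL_2)}\to u_q(\mathfrak{sl}_2)^*$ with $\phi=\overline\phi\circ\pi$. Then $\overline\phi$ is surjective, and hence is an isomorphism of Hopf algebras. Thus the bilinear form $\langle u,x\rangle=\overline\phi(u)(x)$ realizes a perfect duality between $\overline{\mathcal O_q(SL_2)}$ and $u_q(\mathfrak{sl}_2)$, that is, $$\langle uv,x\rangle=\sum\langle u,x_{(1)}\rangle\langle v,x_{(2)}\rangle,\quad \langle u,xy\rangle=\sum\langle u_{(1)},x\rangle\langle u_{(2)},y\rangle,\quad \langle 1,x\rangle=\epsilon(x),\quad \langle u,1\rangle=\epsilon(u),\quad \langle S(u),x\rangle=\langle u,S(x)\rangle$$ for all $u,v\in\overline{\mathcal O_q(SL_2)}$ and $x,y\in u_q(\mathfrak{sl}_2)$, and the two induced linear maps $\overline{\mathcal O_q(SL_2)}\to u_q(\mathfrak{sl}_2)^*$ and $u_q(\mathfrak{sl}_2)\to\overline{\mathcal O_q(SL_2)}^*$ are injective. -/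

import Mathlib

open scoped TensorProduct
open Coalgebra

set_option linter.unusedSectionVars false

noncomputable section

/-! ### The dual of a finite-dimensional Hopf algebra -/

/-- The linear dual `H → k` of a Hopf algebra, with the convolution algebra structure
`(f * g)(x) = f(x₁) g(x₂)`, `1 = ε`. -/
def HopfDual (k H : Type*) [Field k] [Ring H] [HopfAlgebra k H] : Type _ :=
  H →ₗ[k] k

namespace HopfDual

variable {k H : Type*} [Field k] [Ring H] [HopfAlgebra k H]

instance : AddCommGroup (HopfDual k H) := inferInstanceAs (AddCommGroup (H →ₗ[k] k))

instance : Module k (HopfDual k H) := inferInstanceAs (Module k (H →ₗ[k] k))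

instance : FunLike (HopfDual k H) H k := inferInstanceAs (FunLike (H →ₗ[k] k) H k)

instance : LinearMapClass (HopfDual k H) k H k :=
  inferInstanceAs (LinearMapClass (H →ₗ[k] k) k H k)

variable (k H) in
/-- The identification of the type `HopfDual k H` with the space of linear forms on `H`. -/
def toDual : HopfDual k H ≃ₗ[k] Module.Dual k H := LinearEquiv.refl k (H →ₗ[k] k)

@[ext] theorem ext {f g : HopfDual k H} (h : ∀ x, f x = g x) : f = g := DFunLike.ext f g h

@[simp] theorem toDual_apply (f : HopfDual k H) (x : H) : toDual k H f x = f x := rfl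

@[simp] theorem toDual_symm_apply (f : Module.Dual k H) (x : H) :
    (toDual k H).symm f x = f x := rfl

@[simp] theorem add_apply (f g : HopfDual k H) (x : H) : (f + g) x = f x + g x := rfl

@[simp] theorem zero_apply (x : H) : (0 : HopfDual k H) x = 0 := rfl

@[simp] theorem smul_apply (c : k) (f : HopfDual k H) (x : H) : (c • f) x = c * f x := rfl

instance : Mul (HopfDual k H) where
  mul f g := (toDual k H).symm
    (LinearMap.mul' k k ∘ₗ TensorProduct.map (toDual k H f) (toDual k H g) ∘ₗ comul)

instance : One (HopfDual k H) where
  one := (toDual k H).symm counit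

theorem mul_apply (f g : HopfDual k H) (x : H) :
    (f * g) x = LinearMap.mul' k k (TensorProduct.map (toDual k H f) (toDual k H g) (comul x)) :=
  rfl

theorem one_apply (x : H) : (1 : HopfDual k H) x = counit (R := k) x := rfl

instance : Ring (HopfDual k H) where
  __ := (inferInstance : AddCommGroup (HopfDual k H))
  __ := (inferInstance : Mul (HopfDual k H))
  __ := (inferInstance : One (HopfDual k H))
  left_distrib f g h := ext fun x => by
    simp only [mul_apply, add_apply, map_add, TensorProduct.map_add_right, LinearMap.add_apply]
  right_distrib f g h := ext fun x => by
    simp only [mul_apply, add_apply, map_add, TensorProduct.map_add_left, LinearMap.add_apply]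
  zero_mul f := ext fun x => by simp [mul_apply]
  mul_zero f := ext fun x => by simp [mul_apply]
  mul_assoc f g h := congrArg WithConv.ofConv
    (mul_assoc (WithConv.toConv (toDual k H f)) (WithConv.toConv (toDual k H g))
      (WithConv.toConv (toDual k H h)))
  one_mul f := congrArg WithConv.ofConv (one_mul (WithConv.toConv (toDual k H f)))
  mul_one f := congrArg WithConv.ofConv (mul_one (WithConv.toConv (toDual k H f)))

instance : Algebra k (HopfDual k H) :=
  .ofModule
    (fun c f g => ext fun x => by
      simp only [mul_apply, smul_apply, map_smul, TensorProduct.map_smul_left,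
        LinearMap.smul_apply, smul_eq_mul])
    (fun c f g => ext fun x => by
      simp only [mul_apply, smul_apply, map_smul, TensorProduct.map_smul_right,
        LinearMap.smul_apply, smul_eq_mul])

variable [Module.Finite k H]

/-- The isomorphism `H* ⊗ H* ≃ (H ⊗ H)*` for finite-dimensional `H`. -/
def tensorEquiv : HopfDual k H ⊗[k] HopfDual k H ≃ₗ[k] Module.Dual k (H ⊗[k] H) :=
  (TensorProduct.congr (toDual k H)
    (toDual k H)).trans (TensorProduct.dualDistribEquiv k H H)

theorem tensorEquiv_tmul (f g : HopfDual k H) (x y : H) :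
    tensorEquiv (f ⊗ₜ[k] g) (x ⊗ₜ[k] y) = f x * g y := rfl

theorem tensorEquiv_ext {s t : HopfDual k H ⊗[k] HopfDual k H}
    (h : ∀ x y : H, tensorEquiv s (x ⊗ₜ[k] y) = tensorEquiv t (x ⊗ₜ[k] y)) : s = t :=
  tensorEquiv.injective (TensorProduct.ext' h)

/-- The coproduct of `H*`: the transpose of the multiplication of `H`. -/
def comulLin : HopfDual k H →ₗ[k] HopfDual k H ⊗[k] HopfDual k H :=
  tensorEquiv.symm.toLinearMap ∘ₗ (LinearMap.mul' k H).dualMap ∘ₗ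
    (toDual k H).toLinearMap

theorem tensorEquiv_comulLin (f : HopfDual k H) (w : H ⊗[k] H) :
    tensorEquiv (comulLin f) w = f (LinearMap.mul' k H w) := by
  simp [comulLin]

theorem tensorEquiv_mul (s t : HopfDual k H ⊗[k] HopfDual k H) (x y : H) :
    tensorEquiv (s * t) (x ⊗ₜ[k] y) =
      LinearMap.mul' k k (TensorProduct.map (tensorEquiv s) (tensorEquiv t)
        (TensorProduct.tensorTensorTensorComm k H H H H (comul x ⊗ₜ[k] comul y))) := by
  induction s with
  | zero => simp
  | add s₁ s₂ h₁ h₂ => rw [add_mul, map_add, LinearMap.add_apply, h₁, h₂, map_add,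
      TensorProduct.map_add_left, LinearMap.add_apply, map_add]
  | tmul f g =>
    induction t with
    | zero => simp
    | add s₁ s₂ h₁ h₂ => rw [mul_add, map_add, LinearMap.add_apply, h₁, h₂, map_add,
        TensorProduct.map_add_right, LinearMap.add_apply, map_add]
    | tmul f' g' =>
      rw [Algebra.TensorProduct.tmul_mul_tmul, tensorEquiv_tmul, mul_apply, mul_apply]
      generalize (comul x : H ⊗[k] H) = a
      generalize (comul y : H ⊗[k] H) = b
      induction a with
      | zero => simp
      | add a₁ a₂ h₁ h₂ => rw [map_add, map_add, add_mul, h₁, h₂, TensorProduct.add_tmul,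
          map_add, map_add, map_add]
      | tmul a₁ a₂ =>
        induction b with
        | zero => simp
        | add a₁ a₂ h₁ h₂ => rw [map_add, map_add, mul_add, h₁, h₂, TensorProduct.tmul_add,
            map_add, map_add, map_add]
        | tmul b₁ b₂ =>
          simp only [TensorProduct.map_tmul, LinearMap.mul'_apply,
            TensorProduct.tensorTensorTensorComm_tmul, tensorEquiv_tmul, toDual_apply]
          ring

/-- The coproduct of `H*` as an algebra map. -/
def comulHom : HopfDual k H →ₐ[k] HopfDual k H ⊗[k] HopfDual k H :=
  AlgHom.ofLinearMap comulLin
    (by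
      refine tensorEquiv_ext fun x y => ?_
      rw [tensorEquiv_comulLin, Algebra.TensorProduct.one_def, tensorEquiv_tmul]
      simp only [one_apply, LinearMap.mul'_apply, Bialgebra.counit_mul])
    (by
      intro f g
      refine tensorEquiv_ext fun x y => ?_
      rw [tensorEquiv_comulLin, tensorEquiv_mul, mul_apply, LinearMap.mul'_apply,
        Bialgebra.comul_mul]
      generalize (comul x : H ⊗[k] H) = a
      generalize (comul y : H ⊗[k] H) = b
      induction a with
      | zero => simp
      | add a₁ a₂ h₁ h₂ => rw [add_mul, map_add, map_add, h₁, h₂, TensorProduct.add_tmul,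
          map_add, map_add, map_add]
      | tmul a₁ a₂ =>
        induction b with
        | zero => simp
        | add a₁ a₂ h₁ h₂ => rw [mul_add, map_add, map_add, h₁, h₂, TensorProduct.tmul_add,
            map_add, map_add, map_add]
        | tmul b₁ b₂ =>
          simp only [TensorProduct.map_tmul, LinearMap.mul'_apply, tensorEquiv_comulLin,
            TensorProduct.tensorTensorTensorComm_tmul, Algebra.TensorProduct.tmul_mul_tmul,
            toDual_apply])

theorem tensorEquiv_comulHom (f : HopfDual k H) (w : H ⊗[k] H) :
    tensorEquiv (comulHom f) w = f (LinearMap.mul' k H w) :=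
  tensorEquiv_comulLin f w

/-- The counit of `H*`: evaluation at `1`. -/
def counitHom : HopfDual k H →ₐ[k] k :=
  AlgHom.ofLinearMap
    (LinearMap.applyₗ (1 : H) ∘ₗ (toDual k H).toLinearMap)
    (by simp [one_apply])
    (by intro f g; simp [mul_apply, Algebra.TensorProduct.one_def])

theorem counitHom_apply (f : HopfDual k H) : counitHom f = f 1 := rfl

/-- Evaluation of triple tensors, injective by finite-dimensionality. -/
def tensorEquiv₃ : HopfDual k H ⊗[k] (HopfDual k H ⊗[k] HopfDual k H) ≃ₗ[k]
    Module.Dual k (H ⊗[k] (H ⊗[k] H)) :=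
  (TensorProduct.congr (toDual k H) tensorEquiv).trans
    (TensorProduct.dualDistribEquiv k H (H ⊗[k] H))

theorem tensorEquiv₃_tmul (f : HopfDual k H) (t : HopfDual k H ⊗[k] HopfDual k H) (x : H)
    (w : H ⊗[k] H) : tensorEquiv₃ (f ⊗ₜ[k] t) (x ⊗ₜ[k] w) = f x * tensorEquiv t w := rfl

theorem coassoc_left (t : HopfDual k H ⊗[k] HopfDual k H) (x y z : H) :
    tensorEquiv₃ (Algebra.TensorProduct.assoc k k k _ _ _
      (Algebra.TensorProduct.map comulHom (.id k (HopfDual k H)) t)) (x ⊗ₜ[k] (y ⊗ₜ[k] z)) =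
      tensorEquiv t ((x * y) ⊗ₜ[k] z) := by
  induction t with
  | zero => simp
  | add s₁ s₂ h₁ h₂ => rw [map_add, map_add, map_add, LinearMap.add_apply, h₁, h₂, map_add,
      LinearMap.add_apply]
  | tmul f g =>
    rw [Algebra.TensorProduct.map_tmul, tensorEquiv_tmul, AlgHom.id_apply]
    have := tensorEquiv_comulHom f (x ⊗ₜ[k] y)
    rw [LinearMap.mul'_apply] at this
    rw [← this]
    generalize comulHom f = s
    induction s with
    | zero => simp
    | add s₁ s₂ h₁ h₂ => rw [TensorProduct.add_tmul, map_add, map_add, LinearMap.add_apply, h₁, h₂,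
        map_add, LinearMap.add_apply, add_mul]
    | tmul a b =>
      rw [Algebra.TensorProduct.assoc_tmul, tensorEquiv₃_tmul, tensorEquiv_tmul, tensorEquiv_tmul,
        mul_assoc]

theorem coassoc_right (t : HopfDual k H ⊗[k] HopfDual k H) (x y z : H) :
    tensorEquiv₃ (Algebra.TensorProduct.map (.id k (HopfDual k H)) comulHom t)
      (x ⊗ₜ[k] (y ⊗ₜ[k] z)) = tensorEquiv t (x ⊗ₜ[k] (y * z)) := by
  induction t with
  | zero => simp
  | add s₁ s₂ h₁ h₂ => rw [map_add, map_add, LinearMap.add_apply, h₁, h₂, map_add,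
      LinearMap.add_apply]
  | tmul f g =>
    rw [Algebra.TensorProduct.map_tmul, tensorEquiv_tmul, AlgHom.id_apply, tensorEquiv₃_tmul,
      tensorEquiv_comulHom, LinearMap.mul'_apply]

instance : Bialgebra k (HopfDual k H) :=
  .ofAlgHom comulHom counitHom
    (by
      refine AlgHom.ext fun f => tensorEquiv₃.injective ?_
      refine TensorProduct.ext_threefold' fun x y z => ?_
      refine (coassoc_left (comulHom f) x y z).trans
        (Eq.trans ?_ (coassoc_right (comulHom f) x y z).symm)
      rw [tensorEquiv_comulHom, tensorEquiv_comulHom, LinearMap.mul'_apply, LinearMap.mul'_apply,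
        mul_assoc])
    (by
      have key (t : HopfDual k H ⊗[k] HopfDual k H) (x : H) :
          (Algebra.TensorProduct.lid k _ (Algebra.TensorProduct.map counitHom
            (.id k (HopfDual k H)) t)) x = tensorEquiv t (1 ⊗ₜ[k] x) := by
        induction t with
        | zero => simp
        | add s₁ s₂ h₁ h₂ => rw [map_add, map_add, add_apply, h₁, h₂,
            map_add, LinearMap.add_apply]
        | tmul f g => simp [tensorEquiv_tmul, counitHom_apply]
      refine AlgHom.ext fun f => (Algebra.TensorProduct.lid k (HopfDual k H)).injective ?_
      refine ext fun x => ?_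
      refine (key (comulHom f) x).trans ?_
      rw [tensorEquiv_comulHom]
      simp)
    (by
      have key (t : HopfDual k H ⊗[k] HopfDual k H) (x : H) :
          (Algebra.TensorProduct.rid k k _ (Algebra.TensorProduct.map (.id k (HopfDual k H))
            counitHom t)) x = tensorEquiv t (x ⊗ₜ[k] 1) := by
        induction t with
        | zero => simp
        | add s₁ s₂ h₁ h₂ => rw [map_add, map_add, add_apply, h₁, h₂,
            map_add, LinearMap.add_apply]
        | tmul f g => simp [tensorEquiv_tmul, counitHom_apply, mul_comm]
      refine AlgHom.ext fun f => (Algebra.TensorProduct.rid k k (HopfDual k H)).injective ?_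
      refine ext fun x => ?_
      refine (key (comulHom f) x).trans ?_
      rw [tensorEquiv_comulHom]
      simp)

theorem tensorEquiv_comul (f : HopfDual k H) (w : H ⊗[k] H) :
    tensorEquiv (comul f : HopfDual k H ⊗[k] HopfDual k H) w = f (LinearMap.mul' k H w) :=
  tensorEquiv_comulLin f w

theorem counit_apply (f : HopfDual k H) : counit (R := k) f = f 1 := rfl

/-- The antipode of `H*`: the transpose of the antipode of `H`. -/
def antipodeLin : HopfDual k H →ₗ[k] HopfDual k H :=
  (toDual k H).symm.toLinearMap ∘ₗ
    (HopfAlgebra.antipode k (A := H)).dualMap ∘ₗ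
    (toDual k H).toLinearMap

theorem antipodeLin_apply (f : HopfDual k H) (x : H) :
    (antipodeLin f) x = f (HopfAlgebra.antipode k x) := rfl

theorem mul'_map_apply (g h : HopfDual k H →ₗ[k] HopfDual k H) (g' h' : H →ₗ[k] H)
    (hg : ∀ f x, (g f) x = f (g' x)) (hh : ∀ f x, (h f) x = f (h' x))
    (t : HopfDual k H ⊗[k] HopfDual k H) (x : H) :
    (LinearMap.mul' k (HopfDual k H) (TensorProduct.map g h t)) x =
      tensorEquiv t (TensorProduct.map g' h' (comul x)) := by
  induction t with
  | zero => simp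
  | add s₁ s₂ h₁ h₂ => rw [map_add, map_add, add_apply, h₁, h₂,
      map_add, LinearMap.add_apply]
  | tmul a b =>
    rw [TensorProduct.map_tmul, LinearMap.mul'_apply, mul_apply]
    generalize (comul x : H ⊗[k] H) = w
    induction w with
    | zero => simp
    | add s₁ s₂ h₁ h₂ => rw [map_add, map_add, h₁, h₂, map_add, map_add]
    | tmul u v => simp [tensorEquiv_tmul, hg, hh]

instance : HopfAlgebra k (HopfDual k H) where
  antipode := antipodeLin
  mul_antipode_rTensor_comul := by
    refine LinearMap.ext fun f => ext fun x => ?_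
    refine (mul'_map_apply antipodeLin .id (HopfAlgebra.antipode k) .id antipodeLin_apply
      (fun _ _ => rfl) (comul f) x).trans ?_
    rw [tensorEquiv_comul]
    refine (congrArg f (HopfAlgebra.mul_antipode_rTensor_comul_apply x)).trans ?_
    rw [Algebra.algebraMap_eq_smul_one, map_smul, LinearMap.comp_apply, counit_apply,
      Algebra.linearMap_apply, Algebra.algebraMap_eq_smul_one, smul_apply, one_apply,
      smul_eq_mul, mul_comm]
  mul_antipode_lTensor_comul := by
    refine LinearMap.ext fun f => ext fun x => ?_
    refine (mul'_map_apply .id antipodeLin .id (HopfAlgebra.antipode k) (fun _ _ => rfl)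
      antipodeLin_apply (comul f) x).trans ?_
    rw [tensorEquiv_comul]
    refine (congrArg f (HopfAlgebra.mul_antipode_lTensor_comul_apply x)).trans ?_
    rw [Algebra.algebraMap_eq_smul_one, map_smul, LinearMap.comp_apply, counit_apply,
      Algebra.linearMap_apply, Algebra.algebraMap_eq_smul_one, smul_apply, one_apply,
      smul_eq_mul, mul_comm]

end HopfDual

/-! ### Tools for Hopf algebras given by generators and relations -/

namespace QuantumSL2

section Tools

variable {k A : Type*} [Field k] [Ring A]

theorem adjoin_presented {X : Type*} (r : FreeAlgebra k X → FreeAlgebra k X → Prop) :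
    Algebra.adjoin k (Set.range fun x => RingQuot.mkAlgHom k r (FreeAlgebra.ι k x)) = ⊤ := by
  have h : (Set.range fun x => RingQuot.mkAlgHom k r (FreeAlgebra.ι k x)) =
      RingQuot.mkAlgHom k r '' Set.range (FreeAlgebra.ι k) := by
    rw [← Set.range_comp]; rfl
  rw [h, ← AlgHom.map_adjoin, FreeAlgebra.adjoin_range_ι, Algebra.map_top,
    AlgHom.range_eq_top]
  exact RingQuot.mkAlgHom_surjective k r

theorem rTensor_antipode_mul [Bialgebra k A] (S : A →ₗ[k] A)
    (hS : ∀ a b, S (a * b) = S b * S a) {x y : A}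
    (hx : LinearMap.mul' k A (S.rTensor A (comul x)) = algebraMap k A (counit x))
    (hy : LinearMap.mul' k A (S.rTensor A (comul y)) = algebraMap k A (counit y)) :
    LinearMap.mul' k A (S.rTensor A (comul (x * y))) = algebraMap k A (counit (x * y)) := by
  rw [Bialgebra.counit_mul, map_mul (algebraMap k A), ← hy, Bialgebra.comul_mul]
  generalize (comul y : A ⊗[k] A) = t
  induction t with
  | zero => simp
  | add t₁ t₂ h₁ h₂ => rw [mul_add, map_add, map_add, h₁, h₂, map_add, map_add, mul_add]
  | tmul b₁ b₂ =>
    have key (s : A ⊗[k] A) : LinearMap.mul' k A (S.rTensor A (s * b₁ ⊗ₜ[k] b₂)) =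
        S b₁ * LinearMap.mul' k A (S.rTensor A s) * b₂ := by
      induction s with
      | zero => simp
      | add t₁ t₂ h₁ h₂ => rw [add_mul, map_add, map_add, h₁, h₂, map_add, map_add, mul_add, add_mul]
      | tmul a₁ a₂ => simp [hS, mul_assoc]
    rw [key, hx, ← Algebra.commutes, mul_assoc, LinearMap.rTensor_tmul, LinearMap.mul'_apply]

theorem lTensor_antipode_mul [Bialgebra k A] (S : A →ₗ[k] A)
    (hS : ∀ a b, S (a * b) = S b * S a) {x y : A}
    (hx : LinearMap.mul' k A (S.lTensor A (comul x)) = algebraMap k A (counit x))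
    (hy : LinearMap.mul' k A (S.lTensor A (comul y)) = algebraMap k A (counit y)) :
    LinearMap.mul' k A (S.lTensor A (comul (x * y))) = algebraMap k A (counit (x * y)) := by
  rw [Bialgebra.counit_mul, map_mul (algebraMap k A), ← hx, Bialgebra.comul_mul]
  generalize (comul x : A ⊗[k] A) = t
  induction t with
  | zero => simp
  | add t₁ t₂ h₁ h₂ => rw [add_mul, map_add, map_add, h₁, h₂, map_add, map_add, add_mul]
  | tmul b₁ b₂ =>
    have key (s : A ⊗[k] A) : LinearMap.mul' k A (S.lTensor A (b₁ ⊗ₜ[k] b₂ * s)) =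
        b₁ * LinearMap.mul' k A (S.lTensor A s) * S b₂ := by
      induction s with
      | zero => simp
      | add t₁ t₂ h₁ h₂ => rw [mul_add, map_add, map_add, h₁, h₂, map_add, map_add, mul_add, add_mul]
      | tmul a₁ a₂ => simp [hS, mul_assoc]
    rw [key, hy, LinearMap.lTensor_tmul, LinearMap.mul'_apply, mul_assoc, Algebra.commutes,
      mul_assoc]

/-- A bialgebra is a Hopf algebra as soon as an algebra map to the opposite algebra satisfies the
antipode identities on a generating set. -/
@[reducible] def hopfAlgebraOfGenerators [Bialgebra k A] (S : A →ₐ[k] Aᵐᵒᵖ) (s : Set A)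
    (hs : Algebra.adjoin k s = ⊤)
    (hl : ∀ x ∈ s, LinearMap.mul' k A (((MulOpposite.opLinearEquiv k).symm.toLinearMap ∘ₗ
      S.toLinearMap).rTensor A (comul x)) = algebraMap k A (counit x))
    (hr : ∀ x ∈ s, LinearMap.mul' k A (((MulOpposite.opLinearEquiv k).symm.toLinearMap ∘ₗ
      S.toLinearMap).lTensor A (comul x)) = algebraMap k A (counit x)) :
    HopfAlgebra k A where
  antipode := (MulOpposite.opLinearEquiv k).symm.toLinearMap ∘ₗ S.toLinearMap
  mul_antipode_rTensor_comul := by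
    refine LinearMap.ext fun a => ?_
    have ha : a ∈ Algebra.adjoin k s := hs ▸ Algebra.mem_top
    induction ha using Algebra.adjoin_induction with
    | mem x hx => exact hl x hx
    | algebraMap c => simp [Algebra.TensorProduct.one_def, Algebra.algebraMap_eq_smul_one]
    | mul a b _ _ ha hb => exact rTensor_antipode_mul _ (by simp) ha hb
    | add a b _ _ ha hb => rw [map_add, ha, hb, map_add]
  mul_antipode_lTensor_comul := by
    refine LinearMap.ext fun a => ?_
    have ha : a ∈ Algebra.adjoin k s := hs ▸ Algebra.mem_top
    induction ha using Algebra.adjoin_induction with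
    | mem x hx => exact hr x hx
    | algebraMap c => simp [Algebra.TensorProduct.one_def, Algebra.algebraMap_eq_smul_one]
    | mul a b _ _ ha hb => exact lTensor_antipode_mul _ (by simp) ha hb
    | add a b _ _ ha hb => rw [map_add, ha, hb, map_add]

/-- The two-sided ideal generated by a set `s` is a Hopf ideal as soon as the defining conditions
hold on `s`. -/
theorem isHopfIdeal_span [HopfAlgebra k A] (s : Set A)
    (h_counit : ∀ x ∈ s, counit (R := k) x = 0)
    (h_comul : ∀ x ∈ s, Algebra.TensorProduct.map
      (Ideal.Quotient.mkₐ k (TwoSidedIdeal.span s).asIdeal)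
      (Ideal.Quotient.mkₐ k (TwoSidedIdeal.span s).asIdeal) (comul x) = 0)
    (h_antipode : ∀ x ∈ s, HopfAlgebra.antipode k x ∈ TwoSidedIdeal.span s) :
    (TwoSidedIdeal.span s).asIdeal.IsHopfIdeal k where
  counit_eq_zero x hx := by
    have : TwoSidedIdeal.span s ≤ TwoSidedIdeal.ker (Bialgebra.counitAlgHom k A) :=
      TwoSidedIdeal.span_le.2 fun x hx => (TwoSidedIdeal.mem_ker _).2 (h_counit x hx)
    exact (TwoSidedIdeal.mem_ker (Bialgebra.counitAlgHom k A)).1 (this hx)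
  map_mkQ_comul_eq_zero x hx := by
    have : TwoSidedIdeal.span s ≤ TwoSidedIdeal.ker ((Algebra.TensorProduct.map
      (Ideal.Quotient.mkₐ k (TwoSidedIdeal.span s).asIdeal)
      (Ideal.Quotient.mkₐ k (TwoSidedIdeal.span s).asIdeal)).comp (Bialgebra.comulAlgHom k A)) :=
      TwoSidedIdeal.span_le.2 fun x hx => (TwoSidedIdeal.mem_ker _).2 (h_comul x hx)
    exact (TwoSidedIdeal.mem_ker _).1 (this hx)
  antipode_mem x hx := by
    have hx' : x ∈ TwoSidedIdeal.span s := hx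
    change HopfAlgebra.antipode k x ∈ TwoSidedIdeal.span s
    clear hx
    induction hx' using TwoSidedIdeal.span_induction with
    | mem x h => exact h_antipode x h
    | zero => simp
    | add x y hx hy h₁ h₂ => rw [map_add]; exact TwoSidedIdeal.add_mem _ h₁ h₂
    | neg x hx h => rw [map_neg]; exact TwoSidedIdeal.neg_mem _ h
    | left_absorb a x hx h =>
      rw [HopfAlgebra.antipode_mul_antidistrib]; exact TwoSidedIdeal.mul_mem_right _ _ _ h
    | right_absorb b x hx h =>
      rw [HopfAlgebra.antipode_mul_antidistrib]; exact TwoSidedIdeal.mul_mem_left _ _ _ h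

/-- The Gaussian binomial coefficient `[a + b choose a]` at `Q`. -/
def gauss (Q : k) : ℕ → ℕ → k
  | 0, _ => 1
  | _ + 1, 0 => 1
  | a + 1, b + 1 => gauss Q a (b + 1) + Q ^ (a + 1) * gauss Q (a + 1) b

theorem gauss_mul (Q : k) (a b : ℕ) :
    gauss Q a b * ((∏ i ∈ Finset.range a, (1 - Q ^ (i + 1))) *
      ∏ i ∈ Finset.range b, (1 - Q ^ (i + 1))) =
      ∏ i ∈ Finset.range (a + b), (1 - Q ^ (i + 1)) := by
  induction a, b using gauss.induct with
  | case1 b => simp [gauss]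
  | case2 a => simp [gauss]
  | case3 a b h₁ h₂ =>
    rw [gauss, show a + 1 + (b + 1) = a + (b + 1) + 1 by ring, Finset.prod_range_succ _ (a + (b + 1)),
      ← h₁]
    rw [show a + 1 + b = a + (b + 1) by ring, ← h₁] at h₂
    rw [Finset.prod_range_succ _ a] at h₂ ⊢
    rw [Finset.prod_range_succ _ b] at h₁ h₂ ⊢
    linear_combination (Q ^ (a + 1) * (1 - Q ^ (b + 1))) * h₂

theorem gauss_eq_zero {Q : k} {n : ℕ} (hQ : IsPrimitiveRoot Q n) {a b : ℕ} (ha : a ≠ 0)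
    (hb : b ≠ 0) (h : a + b = n) : gauss Q a b = 0 := by
  have hne (m : ℕ) (hm : m < n) : ∏ i ∈ Finset.range m, (1 - Q ^ (i + 1)) ≠ 0 := by
    refine Finset.prod_ne_zero_iff.2 fun i hi => ?_
    rw [Finset.mem_range] at hi
    exact sub_ne_zero.2 (Ne.symm (hQ.pow_ne_one_of_pos_of_lt (by omega) (by omega)))
  have h0 := gauss_mul Q a b
  rw [h, Finset.prod_eq_zero (s := Finset.range n) (i := n - 1) (Finset.mem_range.2 (by omega))
    (by rw [Nat.sub_add_cancel (by omega), hQ.pow_eq_one, sub_self])] at h0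
  exact (mul_eq_zero.1 h0).resolve_right (mul_ne_zero (hne a (by omega)) (hne b (by omega)))

theorem add_pow_gauss [Algebra k A] (Q : k) {x y : A} (h : y * x = Q • (x * y)) (m : ℕ) :
    (x + y) ^ m = ∑ p ∈ Finset.HasAntidiagonal.antidiagonal m, gauss Q p.1 p.2 • (x ^ p.1 * y ^ p.2) := by
  have hyx (a : ℕ) : y * x ^ a = Q ^ a • (x ^ a * y) := by
    induction a with
    | zero => simp
    | succ a ih => rw [pow_succ, ← mul_assoc, ih, smul_mul_assoc, mul_assoc, h, mul_smul_comm,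
        smul_smul, mul_assoc, pow_succ]
  induction m with
  | zero => simp [gauss]
  | succ m ih =>
    let L : ℕ × ℕ → k := fun p => if p.1 = 0 then 0 else gauss Q (p.1 - 1) p.2
    let R : ℕ × ℕ → k := fun p => if p.2 = 0 then 0 else Q ^ p.1 * gauss Q p.1 (p.2 - 1)
    have hLR : ∀ p ∈ Finset.HasAntidiagonal.antidiagonal (m + 1), gauss Q p.1 p.2 • (x ^ p.1 * y ^ p.2) =
        L p • (x ^ p.1 * y ^ p.2) + R p • (x ^ p.1 * y ^ p.2) := by
      rintro ⟨a, b⟩ hab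
      rw [← add_smul]
      congr 1
      rcases a with _ | a <;> rcases b with _ | b
      · simp at hab
      · simp [L, R, gauss]
      · cases a <;> simp [L, R, gauss]
      · simp [L, R, gauss]
    rw [Finset.sum_congr rfl hLR, Finset.sum_add_distrib, Finset.Nat.sum_antidiagonal_succ,
      Finset.Nat.sum_antidiagonal_succ', pow_succ', ih, add_mul, Finset.mul_sum, Finset.mul_sum]
    simp only [L, R, if_true, zero_smul, zero_add, Nat.succ_ne_zero, if_false,
      Nat.add_sub_cancel]
    congr 1
    · refine Finset.sum_congr rfl fun p _ => ?_
      rw [mul_smul_comm, ← mul_assoc, ← pow_succ']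
    · refine Finset.sum_congr rfl fun p _ => ?_
      rw [mul_smul_comm, ← mul_assoc, hyx, smul_mul_assoc, smul_smul, mul_assoc, ← pow_succ',
        mul_comm]

theorem add_pow_of_root [Algebra k A] {Q : k} {n : ℕ} (hn : n ≠ 0) (hQ : IsPrimitiveRoot Q n)
    {x y : A} (h : y * x = Q • (x * y)) : (x + y) ^ n = x ^ n + y ^ n := by
  obtain ⟨m, rfl⟩ := Nat.exists_eq_succ_of_ne_zero hn
  have hz : ∀ p ∈ Finset.HasAntidiagonal.antidiagonal (m + 1), p ∉ ({(m + 1, 0), (0, m + 1)} : Finset (ℕ × ℕ)) →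
      gauss Q p.1 p.2 • (x ^ p.1 * y ^ p.2) = 0 := by
    rintro ⟨a, b⟩ hab hne
    rw [Finset.HasAntidiagonal.mem_antidiagonal] at hab
    simp only [Finset.mem_insert, Finset.mem_singleton, Prod.mk.injEq, not_or] at hne
    rw [gauss_eq_zero hQ (fun h => hne.2 ⟨h, by omega⟩) (fun h => hne.1 ⟨by omega, h⟩) hab,
      zero_smul]
  rw [add_pow_gauss Q h, ← Finset.sum_subset (s₁ := {(m + 1, 0), (0, m + 1)}) (by
    intro p hp
    simp only [Finset.mem_insert, Finset.mem_singleton] at hp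
    rcases hp with rfl | rfl <;> simp) hz, Finset.sum_pair (by simp)]
  simp [gauss]

end Tools

end QuantumSL2
namespace QuantumSL2

/-- The standing assumption on the parameter: `n ≥ 3` is odd and `q` is a primitive `n`-th root of
unity. -/
class OddPrimitiveRoot {k : Type*} [Field k] (q : kˣ) (n : ℕ) : Prop where
  three_le : 3 ≤ n
  odd : Odd n
  isPrimitiveRoot : IsPrimitiveRoot (q : k) n

variable {k : Type*} [Field k] (q : kˣ)

theorem OddPrimitiveRoot.sq {q : kˣ} {n : ℕ} [h : OddPrimitiveRoot q n] :
    IsPrimitiveRoot ((q : k) ^ 2) n :=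
  h.isPrimitiveRoot.pow_of_coprime 2 (Nat.coprime_two_left.2 h.odd)

theorem OddPrimitiveRoot.sub_inv_ne_zero {q : kˣ} (n : ℕ) [h : OddPrimitiveRoot q n] :
    (q : k) - (q : k)⁻¹ ≠ 0 := by
  intro h0
  have h1 : (q : k) ^ 2 = 1 := by
    have : (q : k) = (q : k)⁻¹ := sub_eq_zero.1 h0
    rw [pow_two]
    nth_rewrite 2 [this]
    exact mul_inv_cancel₀ q.ne_zero
  exact h.isPrimitiveRoot.pow_ne_one_of_pos_of_lt two_ne_zero
    (lt_of_lt_of_le (by norm_num) h.three_le) h1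

theorem OddPrimitiveRoot.ne_zero {q : kˣ} {n : ℕ} (h : OddPrimitiveRoot q n) : n ≠ 0 := by
  have := h.three_le
  omega

/-! ### The quantized enveloping algebra `U_q(sl₂)` -/

/-- Generators of `U_q(sl₂)`. -/
inductive UqGen
  | E | F | K | Kinv

open FreeAlgebra in
/-- Defining relations of `U_q(sl₂)`. -/
inductive UqRel : FreeAlgebra k UqGen → FreeAlgebra k UqGen → Prop
  | K_mul_Kinv : UqRel (ι k .K * ι k .Kinv) 1
  | Kinv_mul_K : UqRel (ι k .Kinv * ι k .K) 1
  | K_mul_E : UqRel (ι k .K * ι k .E) ((q : k) ^ 2 • (ι k .E * ι k .K))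
  | K_mul_F : UqRel (ι k .K * ι k .F) (((q : k) ^ 2)⁻¹ • (ι k .F * ι k .K))
  | E_F : UqRel (ι k .E * ι k .F - ι k .F * ι k .E)
      (((q : k) - (q : k)⁻¹)⁻¹ • (ι k .K - ι k .Kinv))

/-- The quantized enveloping algebra `U_q(sl₂)`. -/
def Uq : Type _ := RingQuot (UqRel q)

namespace Uq

instance : Ring (Uq q) := inferInstanceAs (Ring (RingQuot (UqRel q)))

instance : Algebra k (Uq q) := inferInstanceAs (Algebra k (RingQuot (UqRel q)))

/-- The class of a generator. -/
def gen (x : UqGen) : Uq q := RingQuot.mkAlgHom k (UqRel q) (FreeAlgebra.ι k x)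

/-- The generator `E`. -/
abbrev E : Uq q := gen q .E
/-- The generator `F`. -/
abbrev F : Uq q := gen q .F
/-- The generator `K`. -/
abbrev K : Uq q := gen q .K
/-- The generator `K⁻¹`. -/
abbrev Kinv : Uq q := gen q .Kinv

theorem mk_rel {x y : FreeAlgebra k UqGen} (h : UqRel q x y) :
    RingQuot.mkAlgHom k (UqRel q) x = RingQuot.mkAlgHom k (UqRel q) y :=
  RingQuot.mkAlgHom_rel k h

theorem K_mul_Kinv : K q * Kinv q = 1 := by
  have := mk_rel q .K_mul_Kinv
  rw [map_mul, map_one] at this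
  exact this

theorem Kinv_mul_K : Kinv q * K q = 1 := by
  have := mk_rel q .Kinv_mul_K
  rw [map_mul, map_one] at this
  exact this

theorem K_mul_E : K q * E q = (q : k) ^ 2 • (E q * K q) := by
  have := mk_rel q .K_mul_E
  rw [map_smul, map_mul, map_mul] at this
  exact this

theorem K_mul_F : K q * F q = ((q : k) ^ 2)⁻¹ • (F q * K q) := by
  have := mk_rel q .K_mul_F
  rw [map_smul, map_mul, map_mul] at this
  exact this

theorem E_mul_F_sub : E q * F q - F q * E q = ((q : k) - (q : k)⁻¹)⁻¹ • (K q - Kinv q) := by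
  have := mk_rel q .E_F
  rw [map_smul, map_sub, map_sub, map_mul, map_mul] at this
  exact this

theorem adjoin_gen : Algebra.adjoin k (Set.range (gen q)) = ⊤ := adjoin_presented (UqRel q)

variable {q}

theorem algHom_ext {B : Type*} [Ring B] [Algebra k B] {f g : Uq q →ₐ[k] B}
    (h : ∀ x, f (gen q x) = g (gen q x)) : f = g :=
  AlgHom.ext_of_adjoin_eq_top (adjoin_gen q) (by rintro _ ⟨x, rfl⟩; exact h x)

variable (q)

/-- The universal property of `U_q(sl₂)`. -/
def lift {B : Type*} [Ring B] [Algebra k B] (v : UqGen → B)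
    (h₁ : v .K * v .Kinv = 1) (h₂ : v .Kinv * v .K = 1)
    (h₃ : v .K * v .E = (q : k) ^ 2 • (v .E * v .K))
    (h₄ : v .K * v .F = ((q : k) ^ 2)⁻¹ • (v .F * v .K))
    (h₅ : v .E * v .F - v .F * v .E = ((q : k) - (q : k)⁻¹)⁻¹ • (v .K - v .Kinv)) :
    Uq q →ₐ[k] B :=
  RingQuot.liftAlgHom k ⟨FreeAlgebra.lift k v, by
    intro x y h
    cases h with
    | K_mul_Kinv => simpa using h₁
    | Kinv_mul_K => simpa using h₂
    | K_mul_E => simpa using h₃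
    | K_mul_F => simpa using h₄
    | E_F => simpa using h₅⟩

theorem lift_gen {B : Type*} [Ring B] [Algebra k B] (v : UqGen → B) (h₁ h₂ h₃ h₄ h₅) (x : UqGen) :
    lift q v h₁ h₂ h₃ h₄ h₅ (gen q x) = v x := by
  refine (RingQuot.liftAlgHom_mkAlgHom_apply k _ _ _).trans ?_
  simp

theorem Kinv_mul_E : Kinv q * E q = ((q : k) ^ 2)⁻¹ • (E q * Kinv q) := by
  have h : E q = (((q : k) ^ 2)⁻¹) • (K q * E q * Kinv q) := by
    rw [K_mul_E, smul_mul_assoc, mul_assoc, K_mul_Kinv, smul_smul,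
      inv_mul_cancel₀ (pow_ne_zero _ q.ne_zero), one_smul, mul_one]
  nth_rewrite 1 [h]
  rw [mul_smul_comm, ← mul_assoc, ← mul_assoc, Kinv_mul_K, one_mul]

theorem Kinv_mul_F : Kinv q * F q = (q : k) ^ 2 • (F q * Kinv q) := by
  have h : F q = ((q : k) ^ 2) • (K q * F q * Kinv q) := by
    rw [K_mul_F, smul_mul_assoc, mul_assoc, K_mul_Kinv, smul_smul,
      mul_inv_cancel₀ (pow_ne_zero _ q.ne_zero), one_smul, mul_one]
  nth_rewrite 1 [h]
  rw [mul_smul_comm, ← mul_assoc, ← mul_assoc, Kinv_mul_K, one_mul]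

theorem E_mul_F : E q * F q = F q * E q + ((q : k) - (q : k)⁻¹)⁻¹ • (K q - Kinv q) := by
  rw [← E_mul_F_sub]; abel

/-- Values of the coproduct on generators. -/
def comulGen : UqGen → Uq q ⊗[k] Uq q
  | .E => 1 ⊗ₜ E q + E q ⊗ₜ K q
  | .F => Kinv q ⊗ₜ F q + F q ⊗ₜ 1
  | .K => K q ⊗ₜ K q
  | .Kinv => Kinv q ⊗ₜ Kinv q

/-- The coproduct of `U_q(sl₂)`. -/
def comulHom : Uq q →ₐ[k] Uq q ⊗[k] Uq q :=
  lift q (comulGen q)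
    (by simp only [comulGen, Algebra.TensorProduct.tmul_mul_tmul, K_mul_Kinv,
      Algebra.TensorProduct.one_def])
    (by simp only [comulGen, Algebra.TensorProduct.tmul_mul_tmul, Kinv_mul_K,
      Algebra.TensorProduct.one_def])
    (by simp only [comulGen, mul_add, add_mul, Algebra.TensorProduct.tmul_mul_tmul, K_mul_E,
      mul_one, one_mul, TensorProduct.tmul_smul, ← TensorProduct.smul_tmul', smul_add])
    (by simp only [comulGen, mul_add, add_mul, Algebra.TensorProduct.tmul_mul_tmul, K_mul_F,
      mul_one, one_mul, TensorProduct.tmul_smul, ← TensorProduct.smul_tmul', smul_add,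
      K_mul_Kinv, Kinv_mul_K])
    (by
      simp only [comulGen, mul_add, add_mul, Algebra.TensorProduct.tmul_mul_tmul, K_mul_F,
        mul_one, one_mul, TensorProduct.tmul_smul, ← TensorProduct.smul_tmul', Kinv_mul_E, E_mul_F,
        TensorProduct.tmul_add, TensorProduct.add_tmul, TensorProduct.tmul_sub,
        TensorProduct.sub_tmul]
      module)

/-- Values of the counit on generators. -/
def counitGen : UqGen → k
  | .E => 0
  | .F => 0
  | .K => 1
  | .Kinv => 1

/-- The counit of `U_q(sl₂)`. -/
def counitHom : Uq q →ₐ[k] k :=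
  lift q counitGen (by simp [counitGen]) (by simp [counitGen]) (by simp [counitGen])
    (by simp [counitGen]) (by simp [counitGen])

theorem comulHom_gen (x : UqGen) : comulHom q (gen q x) = comulGen q x := lift_gen ..

theorem counitHom_gen (x : UqGen) : counitHom q (gen q x) = counitGen x := lift_gen ..

instance : Bialgebra k (Uq q) :=
  .ofAlgHom (comulHom q) (counitHom q)
    (algHom_ext fun x => by
      cases x <;> simp [comulHom_gen, comulGen, TensorProduct.add_tmul, TensorProduct.tmul_add,
        Algebra.TensorProduct.one_def, add_assoc])
    (algHom_ext fun x => by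
      cases x <;> simp [comulHom_gen, comulGen, counitHom_gen, counitGen])
    (algHom_ext fun x => by
      cases x <;> simp [comulHom_gen, comulGen, counitHom_gen, counitGen])

theorem comul_gen (x : UqGen) : comul (R := k) (gen q x) = comulGen q x := comulHom_gen q x

theorem counit_gen (x : UqGen) : counit (R := k) (gen q x) = counitGen x := counitHom_gen q x

/-- Values of the antipode on generators. -/
def antipodeGen : UqGen → Uq q
  | .E => -(E q * Kinv q)
  | .F => -(K q * F q)
  | .K => Kinv q
  | .Kinv => K q

/-- The antipode of `U_q(sl₂)`, as an algebra map to the opposite algebra. -/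
def antipodeHom : Uq q →ₐ[k] (Uq q)ᵐᵒᵖ :=
  lift q (fun x => MulOpposite.op (antipodeGen q x))
    (by rw [← MulOpposite.op_mul]; exact congrArg MulOpposite.op (K_mul_Kinv q))
    (by rw [← MulOpposite.op_mul]; exact congrArg MulOpposite.op (Kinv_mul_K q))
    (by
      rw [← MulOpposite.op_mul, ← MulOpposite.op_mul, ← MulOpposite.op_smul]
      refine congrArg MulOpposite.op ?_
      simp only [antipodeGen, mul_neg, neg_mul, ← mul_assoc, Kinv_mul_E, smul_mul_assoc, smul_neg]
      rw [smul_smul, mul_inv_cancel₀ (pow_ne_zero _ q.ne_zero), one_smul])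
    (by
      rw [← MulOpposite.op_mul, ← MulOpposite.op_mul, ← MulOpposite.op_smul]
      refine congrArg MulOpposite.op ?_
      simp only [antipodeGen, mul_neg, neg_mul, ← mul_assoc, Kinv_mul_K, one_mul, smul_neg]
      rw [K_mul_F, smul_mul_assoc, mul_assoc, K_mul_Kinv, mul_one])
    (by
      rw [← MulOpposite.op_mul, ← MulOpposite.op_mul, ← MulOpposite.op_sub, ← MulOpposite.op_sub,
        ← MulOpposite.op_smul]
      refine congrArg MulOpposite.op ?_
      simp only [antipodeGen, mul_neg, neg_mul, neg_neg]
      have h1 : K q * F q * (E q * Kinv q) = F q * E q := by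
        rw [K_mul_F, smul_mul_assoc, mul_assoc (F q), ← mul_assoc (K q), K_mul_E, smul_mul_assoc,
          mul_assoc (E q), K_mul_Kinv, mul_smul_comm, smul_smul,
          inv_mul_cancel₀ (pow_ne_zero _ q.ne_zero), one_smul, mul_one]
      have h2 : E q * Kinv q * (K q * F q) = E q * F q := by
        rw [mul_assoc, ← mul_assoc (Kinv q), Kinv_mul_K, one_mul]
      rw [h1, h2, E_mul_F]
      module)

theorem antipodeHom_gen (x : UqGen) :
    antipodeHom q (gen q x) = MulOpposite.op (antipodeGen q x) := lift_gen ..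

instance : HopfAlgebra k (Uq q) :=
  hopfAlgebraOfGenerators (antipodeHom q) _ (adjoin_gen q)
    (by
      rintro _ ⟨x, rfl⟩
      rw [comul_gen, counit_gen]
      cases x <;> simp [comulGen, counitGen, antipodeHom_gen, antipodeGen, K_mul_Kinv,
        Kinv_mul_K, mul_assoc])
    (by
      rintro _ ⟨x, rfl⟩
      rw [comul_gen, counit_gen]
      cases x <;> simp [comulGen, counitGen, antipodeHom_gen, antipodeGen, K_mul_Kinv,
        Kinv_mul_K, ← mul_assoc])

theorem antipode_gen (x : UqGen) : HopfAlgebra.antipode k (gen q x) = antipodeGen q x :=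
  congrArg MulOpposite.unop (antipodeHom_gen q x)

end Uq

end QuantumSL2
namespace QuantumSL2

/-! ### The quantized coordinate ring `O_q(SL₂)` -/

section Oq

variable {k : Type*} [Field k] (q : kˣ)

/-- Generators of `O_q(SL₂)`. -/
inductive OqGen
  | a | b | c | d

open FreeAlgebra in
/-- Defining relations of `O_q(SL₂)`. -/
inductive OqRel : FreeAlgebra k OqGen → FreeAlgebra k OqGen → Prop
  | b_mul_a : OqRel (ι k .b * ι k .a) ((q : k) • (ι k .a * ι k .b))
  | c_mul_a : OqRel (ι k .c * ι k .a) ((q : k) • (ι k .a * ι k .c))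
  | d_mul_b : OqRel (ι k .d * ι k .b) ((q : k) • (ι k .b * ι k .d))
  | d_mul_c : OqRel (ι k .d * ι k .c) ((q : k) • (ι k .c * ι k .d))
  | b_mul_c : OqRel (ι k .b * ι k .c) (ι k .c * ι k .b)
  | a_mul_d : OqRel (ι k .a * ι k .d) ((q : k)⁻¹ • (ι k .b * ι k .c) + 1)
  | d_mul_a : OqRel (ι k .d * ι k .a) ((q : k) • (ι k .b * ι k .c) + 1)

/-- The quantized coordinate ring `O_q(SL₂)`. -/
def Oq : Type _ := RingQuot (OqRel q)

namespace Oq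

instance : Ring (Oq q) := inferInstanceAs (Ring (RingQuot (OqRel q)))

instance : Algebra k (Oq q) := inferInstanceAs (Algebra k (RingQuot (OqRel q)))

/-- The class of a generator. -/
def gen (x : OqGen) : Oq q := RingQuot.mkAlgHom k (OqRel q) (FreeAlgebra.ι k x)

/-- The generator `a`. -/
abbrev a : Oq q := gen q .a
/-- The generator `b`. -/
abbrev b : Oq q := gen q .b
/-- The generator `c`. -/
abbrev c : Oq q := gen q .c
/-- The generator `d`. -/
abbrev d : Oq q := gen q .d

theorem mk_rel {x y : FreeAlgebra k OqGen} (h : OqRel q x y) :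
    RingQuot.mkAlgHom k (OqRel q) x = RingQuot.mkAlgHom k (OqRel q) y :=
  RingQuot.mkAlgHom_rel k h

theorem b_mul_a : b q * a q = (q : k) • (a q * b q) := by
  have := mk_rel q .b_mul_a
  rw [map_smul, map_mul, map_mul] at this
  exact this

theorem c_mul_a : c q * a q = (q : k) • (a q * c q) := by
  have := mk_rel q .c_mul_a
  rw [map_smul, map_mul, map_mul] at this
  exact this

theorem d_mul_b : d q * b q = (q : k) • (b q * d q) := by
  have := mk_rel q .d_mul_b
  rw [map_smul, map_mul, map_mul] at this
  exact this

theorem d_mul_c : d q * c q = (q : k) • (c q * d q) := by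
  have := mk_rel q .d_mul_c
  rw [map_smul, map_mul, map_mul] at this
  exact this

theorem c_mul_b : c q * b q = b q * c q := by
  have := mk_rel q .b_mul_c
  rw [map_mul, map_mul] at this
  exact this.symm

theorem a_mul_d : a q * d q = (q : k)⁻¹ • (b q * c q) + 1 := by
  have := mk_rel q .a_mul_d
  rw [map_add, map_smul, map_mul, map_mul, map_one] at this
  exact this

theorem d_mul_a : d q * a q = (q : k) • (b q * c q) + 1 := by
  have := mk_rel q .d_mul_a
  rw [map_add, map_smul, map_mul, map_mul, map_one] at this
  exact this

theorem adjoin_gen : Algebra.adjoin k (Set.range (gen q)) = ⊤ := adjoin_presented (OqRel q)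

variable {q}

theorem algHom_ext {B : Type*} [Ring B] [Algebra k B] {f g : Oq q →ₐ[k] B}
    (h : ∀ x, f (gen q x) = g (gen q x)) : f = g :=
  AlgHom.ext_of_adjoin_eq_top (adjoin_gen q) (by rintro _ ⟨x, rfl⟩; exact h x)

variable (q)

/-- The universal property of `O_q(SL₂)`. -/
def lift {B : Type*} [Ring B] [Algebra k B] (v : OqGen → B)
    (h₁ : v .b * v .a = (q : k) • (v .a * v .b)) (h₂ : v .c * v .a = (q : k) • (v .a * v .c))
    (h₃ : v .d * v .b = (q : k) • (v .b * v .d)) (h₄ : v .d * v .c = (q : k) • (v .c * v .d))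
    (h₅ : v .b * v .c = v .c * v .b) (h₆ : v .a * v .d = (q : k)⁻¹ • (v .b * v .c) + 1)
    (h₇ : v .d * v .a = (q : k) • (v .b * v .c) + 1) :
    Oq q →ₐ[k] B :=
  RingQuot.liftAlgHom k ⟨FreeAlgebra.lift k v, by
    intro x y h
    cases h with
    | b_mul_a => simpa using h₁
    | c_mul_a => simpa using h₂
    | d_mul_b => simpa using h₃
    | d_mul_c => simpa using h₄
    | b_mul_c => simpa using h₅
    | a_mul_d => simpa using h₆
    | d_mul_a => simpa using h₇⟩

theorem lift_gen {B : Type*} [Ring B] [Algebra k B] (v : OqGen → B) (h₁ h₂ h₃ h₄ h₅ h₆ h₇)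
    (x : OqGen) : lift q v h₁ h₂ h₃ h₄ h₅ h₆ h₇ (gen q x) = v x := by
  refine (RingQuot.liftAlgHom_mkAlgHom_apply k _ _ _).trans ?_
  simp

/-- Values of the coproduct on generators. -/
def comulGen : OqGen → Oq q ⊗[k] Oq q
  | .a => a q ⊗ₜ a q + b q ⊗ₜ c q
  | .b => a q ⊗ₜ b q + b q ⊗ₜ d q
  | .c => c q ⊗ₜ a q + d q ⊗ₜ c q
  | .d => c q ⊗ₜ b q + d q ⊗ₜ d q

theorem comulGen_rel :
    (comulGen q .b * comulGen q .a = (q : k) • (comulGen q .a * comulGen q .b)) ∧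
    (comulGen q .c * comulGen q .a = (q : k) • (comulGen q .a * comulGen q .c)) ∧
    (comulGen q .d * comulGen q .b = (q : k) • (comulGen q .b * comulGen q .d)) ∧
    (comulGen q .d * comulGen q .c = (q : k) • (comulGen q .c * comulGen q .d)) ∧
    (comulGen q .b * comulGen q .c = comulGen q .c * comulGen q .b) ∧
    (comulGen q .a * comulGen q .d = (q : k)⁻¹ • (comulGen q .b * comulGen q .c) + 1) ∧
    (comulGen q .d * comulGen q .a = (q : k) • (comulGen q .b * comulGen q .c) + 1) := by
  have hq : (q : k) ≠ 0 := q.ne_zero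
  refine ⟨?_, ?_, ?_, ?_, ?_, ?_, ?_⟩ <;>
    simp only [comulGen, mul_add, add_mul, Algebra.TensorProduct.tmul_mul_tmul, b_mul_a, c_mul_a,
      d_mul_b, d_mul_c, c_mul_b, a_mul_d, d_mul_a, TensorProduct.tmul_add, TensorProduct.add_tmul,
      TensorProduct.tmul_smul, ← TensorProduct.smul_tmul', Algebra.TensorProduct.one_def] <;>
    match_scalars <;> field_simp

/-- The coproduct of `O_q(SL₂)`. -/
def comulHom : Oq q →ₐ[k] Oq q ⊗[k] Oq q :=
  lift q (comulGen q) (comulGen_rel q).1 (comulGen_rel q).2.1 (comulGen_rel q).2.2.1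
    (comulGen_rel q).2.2.2.1 (comulGen_rel q).2.2.2.2.1 (comulGen_rel q).2.2.2.2.2.1
    (comulGen_rel q).2.2.2.2.2.2

/-- Values of the counit on generators. -/
def counitGen : OqGen → k
  | .a => 1
  | .b => 0
  | .c => 0
  | .d => 1

/-- The counit of `O_q(SL₂)`. -/
def counitHom : Oq q →ₐ[k] k :=
  lift q counitGen (by simp [counitGen]) (by simp [counitGen]) (by simp [counitGen])
    (by simp [counitGen]) (by simp [counitGen]) (by simp [counitGen]) (by simp [counitGen])

theorem comulHom_gen (x : OqGen) : comulHom q (gen q x) = comulGen q x := lift_gen ..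

theorem counitHom_gen (x : OqGen) : counitHom q (gen q x) = counitGen x := lift_gen ..

instance : Bialgebra k (Oq q) :=
  .ofAlgHom (comulHom q) (counitHom q)
    (algHom_ext fun x => by
      cases x <;> simp [comulHom_gen, comulGen, TensorProduct.add_tmul, TensorProduct.tmul_add] <;>
        abel)
    (algHom_ext fun x => by
      cases x <;> simp [comulHom_gen, comulGen, counitHom_gen, counitGen])
    (algHom_ext fun x => by
      cases x <;> simp [comulHom_gen, comulGen, counitHom_gen, counitGen])

theorem comul_gen (x : OqGen) : comul (R := k) (gen q x) = comulGen q x := comulHom_gen q x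

theorem counit_gen (x : OqGen) : counit (R := k) (gen q x) = counitGen x := counitHom_gen q x

/-- Values of the antipode on generators. -/
def antipodeGen : OqGen → Oq q
  | .a => d q
  | .b => -((q : k) • b q)
  | .c => -((q : k)⁻¹ • c q)
  | .d => a q

theorem antipodeGen_rel :
    (antipodeGen q .a * antipodeGen q .b = (q : k) • (antipodeGen q .b * antipodeGen q .a)) ∧
    (antipodeGen q .a * antipodeGen q .c = (q : k) • (antipodeGen q .c * antipodeGen q .a)) ∧
    (antipodeGen q .b * antipodeGen q .d = (q : k) • (antipodeGen q .d * antipodeGen q .b)) ∧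
    (antipodeGen q .c * antipodeGen q .d = (q : k) • (antipodeGen q .d * antipodeGen q .c)) ∧
    (antipodeGen q .c * antipodeGen q .b = antipodeGen q .b * antipodeGen q .c) ∧
    (antipodeGen q .d * antipodeGen q .a =
      (q : k)⁻¹ • (antipodeGen q .c * antipodeGen q .b) + 1) ∧
    (antipodeGen q .a * antipodeGen q .d =
      (q : k) • (antipodeGen q .c * antipodeGen q .b) + 1) := by
  have hq : (q : k) ≠ 0 := q.ne_zero
  refine ⟨?_, ?_, ?_, ?_, ?_, ?_, ?_⟩ <;>
    simp only [antipodeGen, mul_neg, neg_mul, smul_mul_assoc, mul_smul_comm, b_mul_a, c_mul_a,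
      d_mul_b, d_mul_c, c_mul_b, a_mul_d, d_mul_a] <;>
    match_scalars <;> field_simp

/-- The antipode of `O_q(SL₂)`, as an algebra map to the opposite algebra. -/
def antipodeHom : Oq q →ₐ[k] (Oq q)ᵐᵒᵖ :=
  lift q (fun x => MulOpposite.op (antipodeGen q x))
    (congrArg MulOpposite.op (antipodeGen_rel q).1)
    (congrArg MulOpposite.op (antipodeGen_rel q).2.1)
    (congrArg MulOpposite.op (antipodeGen_rel q).2.2.1)
    (congrArg MulOpposite.op (antipodeGen_rel q).2.2.2.1)
    (congrArg MulOpposite.op (antipodeGen_rel q).2.2.2.2.1)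
    (congrArg MulOpposite.op (antipodeGen_rel q).2.2.2.2.2.1)
    (congrArg MulOpposite.op (antipodeGen_rel q).2.2.2.2.2.2)

theorem antipodeHom_gen (x : OqGen) :
    antipodeHom q (gen q x) = MulOpposite.op (antipodeGen q x) := lift_gen ..

instance : HopfAlgebra k (Oq q) :=
  hopfAlgebraOfGenerators (antipodeHom q) _ (adjoin_gen q)
    (by
      rintro _ ⟨x, rfl⟩
      rw [comul_gen, counit_gen]
      cases x <;> simp [comulGen, counitGen, antipodeHom_gen, antipodeGen, c_mul_a,
        d_mul_b, c_mul_b, a_mul_d, d_mul_a])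
    (by
      rintro _ ⟨x, rfl⟩
      rw [comul_gen, counit_gen]
      cases x <;> simp [comulGen, counitGen, antipodeHom_gen, antipodeGen, b_mul_a, d_mul_c,
        c_mul_b, a_mul_d, d_mul_a])

theorem antipode_gen (x : OqGen) : HopfAlgebra.antipode k (gen q x) = antipodeGen q x :=
  congrArg MulOpposite.unop (antipodeHom_gen q x)

end Oq

end Oq

/-! ### The finite-dimensional quotients -/

section Quotients

variable {k : Type*} [Field k] (q : kˣ) (n : ℕ)

theorem antipode_pow {A : Type*} [Ring A] [HopfAlgebra k A] (x : A) (m : ℕ) :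
    HopfAlgebra.antipode k (x ^ m) = HopfAlgebra.antipode k x ^ m := by
  induction m with
  | zero => simp
  | succ m ih => rw [pow_succ, HopfAlgebra.antipode_mul_antidistrib, ih, pow_succ']

theorem mul_pow_of_smul {A : Type*} [Ring A] [Algebra k A] {x y : A} {r : k}
    (h : y * x = r • (x * y)) (m : ℕ) : ∃ s : k, (x * y) ^ m = s • (x ^ m * y ^ m) := by
  have hyx (j : ℕ) : y * x ^ j = r ^ j • (x ^ j * y) := by
    induction j with
    | zero => simp
    | succ j ih => rw [pow_succ, ← mul_assoc, ih, smul_mul_assoc, mul_assoc, h, mul_smul_comm,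
        smul_smul, mul_assoc, pow_succ]
  induction m with
  | zero => exact ⟨1, by simp⟩
  | succ m ih =>
    obtain ⟨s, hs⟩ := ih
    refine ⟨s * r ^ m, ?_⟩
    rw [pow_succ', hs, mul_smul_comm, mul_assoc, ← mul_assoc y, hyx, smul_mul_assoc, mul_smul_comm,
      smul_smul, mul_assoc, ← pow_succ', ← mul_assoc, ← pow_succ']

theorem smul_mem_span {A : Type*} [Ring A] [Algebra k A] {s : Set A} {x : A} (r : k)
    (h : x ∈ TwoSidedIdeal.span s) : r • x ∈ TwoSidedIdeal.span s := by
  rw [Algebra.smul_def]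
  exact TwoSidedIdeal.mul_mem_left _ _ _ h

/-- The two-sided ideal of `U_q(sl₂)` generated by `K ^ n - 1`, `E ^ n`, `F ^ n`. -/
abbrev uqIdeal : Ideal (Uq q) :=
  (TwoSidedIdeal.span {Uq.K q ^ n - 1, Uq.E q ^ n, Uq.F q ^ n}).asIdeal

/-- The two-sided ideal of `O_q(SL₂)` generated by `a ^ n - 1`, `b ^ n`, `c ^ n`, `d ^ n - 1`. -/
abbrev oqIdeal : Ideal (Oq q) :=
  (TwoSidedIdeal.span {Oq.a q ^ n - 1, Oq.b q ^ n, Oq.c q ^ n, Oq.d q ^ n - 1}).asIdeal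

theorem mk_of_mem {A : Type*} [Ring A] [Algebra k A] {s : Set A} {x : A} (h : x ∈ s) :
    Ideal.Quotient.mkₐ k (TwoSidedIdeal.span s).asIdeal x = 0 :=
  Ideal.Quotient.eq_zero_iff_mem.2 (TwoSidedIdeal.subset_span h)

instance [h : OddPrimitiveRoot q n] : (uqIdeal q n).IsHopfIdeal k := by
  have hn : n ≠ 0 := h.ne_zero
  have hQ := h.sq
  have hK := mk_of_mem (k := k)
    (s := {Uq.K q ^ n - 1, Uq.E q ^ n, Uq.F q ^ n}) (x := Uq.K q ^ n - 1) (by simp)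
  have hE := mk_of_mem (k := k)
    (s := {Uq.K q ^ n - 1, Uq.E q ^ n, Uq.F q ^ n}) (x := Uq.E q ^ n) (by simp)
  have hF := mk_of_mem (k := k)
    (s := {Uq.K q ^ n - 1, Uq.E q ^ n, Uq.F q ^ n}) (x := Uq.F q ^ n) (by simp)
  rw [map_sub, map_one, sub_eq_zero] at hK
  refine isHopfIdeal_span _ ?_ ?_ ?_
  · rintro _ (rfl | rfl | rfl)
    · simp [Uq.counit_gen, Uq.counitGen]
    · simp [Uq.counit_gen, Uq.counitGen, hn]
    · simp [Uq.counit_gen, Uq.counitGen, hn]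
  · rintro _ (rfl | rfl | rfl)
    · rw [map_sub, Bialgebra.comul_pow, Uq.comul_gen, Uq.comulGen, Algebra.TensorProduct.tmul_pow,
        Bialgebra.comul_one, map_sub, map_one, Algebra.TensorProduct.map_tmul, hK,
        Algebra.TensorProduct.one_def, sub_self]
    · rw [Bialgebra.comul_pow, Uq.comul_gen, Uq.comulGen, add_pow_of_root hn hQ (by
        simp only [Algebra.TensorProduct.tmul_mul_tmul, mul_one, one_mul, Uq.K_mul_E,
          TensorProduct.tmul_smul]), Algebra.TensorProduct.tmul_pow,
        Algebra.TensorProduct.tmul_pow, map_add, Algebra.TensorProduct.map_tmul,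
        Algebra.TensorProduct.map_tmul, hE, TensorProduct.tmul_zero, TensorProduct.zero_tmul,
        add_zero]
    · rw [Bialgebra.comul_pow, Uq.comul_gen, Uq.comulGen, add_comm, add_pow_of_root hn hQ (by
        simp only [Algebra.TensorProduct.tmul_mul_tmul, mul_one, one_mul, Uq.Kinv_mul_F,
          ← TensorProduct.smul_tmul']), Algebra.TensorProduct.tmul_pow,
        Algebra.TensorProduct.tmul_pow, map_add, Algebra.TensorProduct.map_tmul,
        Algebra.TensorProduct.map_tmul, hF, TensorProduct.tmul_zero, TensorProduct.zero_tmul,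
        add_zero]
  · rintro _ (rfl | rfl | rfl)
    · have hc : Commute (Uq.Kinv q) (Uq.K q) := (Uq.Kinv_mul_K q).trans (Uq.K_mul_Kinv q).symm
      have : HopfAlgebra.antipode k (Uq.K q ^ n - 1) = -(Uq.Kinv q ^ n * (Uq.K q ^ n - 1)) := by
        rw [map_sub, antipode_pow, Uq.antipode_gen, HopfAlgebra.antipode_one, mul_sub,
          ← hc.mul_pow, Uq.Kinv_mul_K, one_pow, mul_one, neg_sub, Uq.antipodeGen]
      rw [this]
      exact TwoSidedIdeal.neg_mem _ (TwoSidedIdeal.mul_mem_left _ _ _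
        (TwoSidedIdeal.subset_span (by simp)))
    · obtain ⟨r, hr⟩ := mul_pow_of_smul (Uq.Kinv_mul_E q) n
      rw [antipode_pow, Uq.antipode_gen, Uq.antipodeGen, neg_pow, hr]
      exact TwoSidedIdeal.mul_mem_left _ _ _ (smul_mem_span _ (TwoSidedIdeal.mul_mem_right _ _ _
        (TwoSidedIdeal.subset_span (by simp))))
    · have hFK : Uq.F q * Uq.K q = (q : k) ^ 2 • (Uq.K q * Uq.F q) := by
        rw [Uq.K_mul_F, smul_smul, mul_inv_cancel₀ (pow_ne_zero _ q.ne_zero), one_smul]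
      obtain ⟨r, hr⟩ := mul_pow_of_smul hFK n
      rw [antipode_pow, Uq.antipode_gen, Uq.antipodeGen, neg_pow, hr]
      exact TwoSidedIdeal.mul_mem_left _ _ _ (smul_mem_span _ (TwoSidedIdeal.mul_mem_left _ _ _
        (TwoSidedIdeal.subset_span (by simp))))

theorem Oq.comul_pow_gen [h : OddPrimitiveRoot q n] :
    comul (R := k) (Oq.a q ^ n) =
      (Oq.a q ^ n) ⊗ₜ[k] (Oq.a q ^ n) + (Oq.b q ^ n) ⊗ₜ[k] (Oq.c q ^ n) ∧
    comul (R := k) (Oq.b q ^ n) =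
      (Oq.a q ^ n) ⊗ₜ[k] (Oq.b q ^ n) + (Oq.b q ^ n) ⊗ₜ[k] (Oq.d q ^ n) ∧
    comul (R := k) (Oq.c q ^ n) =
      (Oq.c q ^ n) ⊗ₜ[k] (Oq.a q ^ n) + (Oq.d q ^ n) ⊗ₜ[k] (Oq.c q ^ n) ∧
    comul (R := k) (Oq.d q ^ n) =
      (Oq.c q ^ n) ⊗ₜ[k] (Oq.b q ^ n) + (Oq.d q ^ n) ⊗ₜ[k] (Oq.d q ^ n) := by
  have hn : n ≠ 0 := h.ne_zero
  refine ⟨?_, ?_, ?_, ?_⟩ <;>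
  · rw [Bialgebra.comul_pow, Oq.comul_gen, Oq.comulGen, add_pow_of_root hn h.sq (by
        simp only [Algebra.TensorProduct.tmul_mul_tmul, Oq.b_mul_a, Oq.c_mul_a, Oq.d_mul_b,
          Oq.d_mul_c, TensorProduct.tmul_smul, ← TensorProduct.smul_tmul', smul_smul, pow_two]),
      Algebra.TensorProduct.tmul_pow, Algebra.TensorProduct.tmul_pow]

instance [h : OddPrimitiveRoot q n] : (oqIdeal q n).IsHopfIdeal k := by
  have hn : n ≠ 0 := h.ne_zero
  have ha := mk_of_mem (k := k) (s := {Oq.a q ^ n - 1, Oq.b q ^ n, Oq.c q ^ n, Oq.d q ^ n - 1})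
    (x := Oq.a q ^ n - 1) (by simp)
  have hb := mk_of_mem (k := k) (s := {Oq.a q ^ n - 1, Oq.b q ^ n, Oq.c q ^ n, Oq.d q ^ n - 1})
    (x := Oq.b q ^ n) (by simp)
  have hc := mk_of_mem (k := k) (s := {Oq.a q ^ n - 1, Oq.b q ^ n, Oq.c q ^ n, Oq.d q ^ n - 1})
    (x := Oq.c q ^ n) (by simp)
  have hd := mk_of_mem (k := k) (s := {Oq.a q ^ n - 1, Oq.b q ^ n, Oq.c q ^ n, Oq.d q ^ n - 1})
    (x := Oq.d q ^ n - 1) (by simp)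
  rw [map_sub, map_one, sub_eq_zero] at ha hd
  obtain ⟨h₁, h₂, h₃, h₄⟩ := Oq.comul_pow_gen q n
  refine isHopfIdeal_span _ ?_ ?_ ?_
  · rintro _ (rfl | rfl | rfl | rfl) <;> simp [Oq.counit_gen, Oq.counitGen, hn]
  · rintro _ (rfl | rfl | rfl | rfl)
    · rw [map_sub, h₁, Bialgebra.comul_one, map_sub, map_add, map_one,
        Algebra.TensorProduct.map_tmul, Algebra.TensorProduct.map_tmul, ha, hb, hc,
        TensorProduct.tmul_zero, add_zero, Algebra.TensorProduct.one_def, sub_self]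
    · rw [h₂, map_add, Algebra.TensorProduct.map_tmul, Algebra.TensorProduct.map_tmul, hb,
        TensorProduct.tmul_zero, TensorProduct.zero_tmul, add_zero]
    · rw [h₃, map_add, Algebra.TensorProduct.map_tmul, Algebra.TensorProduct.map_tmul, hc,
        TensorProduct.tmul_zero, TensorProduct.zero_tmul, add_zero]
    · rw [map_sub, h₄, Bialgebra.comul_one, map_sub, map_add, map_one,
        Algebra.TensorProduct.map_tmul, Algebra.TensorProduct.map_tmul, hd, hb, hc,
        TensorProduct.tmul_zero, zero_add, Algebra.TensorProduct.one_def, sub_self]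
  · rintro _ (rfl | rfl | rfl | rfl)
    · rw [map_sub, antipode_pow, Oq.antipode_gen, HopfAlgebra.antipode_one]
      exact TwoSidedIdeal.subset_span (by simp [Oq.antipodeGen])
    · rw [antipode_pow, Oq.antipode_gen, Oq.antipodeGen, ← neg_smul, smul_pow]
      exact smul_mem_span _ (TwoSidedIdeal.subset_span (by simp))
    · rw [antipode_pow, Oq.antipode_gen, Oq.antipodeGen, ← neg_smul, smul_pow]
      exact smul_mem_span _ (TwoSidedIdeal.subset_span (by simp))
    · rw [map_sub, antipode_pow, Oq.antipode_gen, HopfAlgebra.antipode_one]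
      exact TwoSidedIdeal.subset_span (by simp [Oq.antipodeGen])

/-- The Frobenius-Lusztig kernel `u_q(sl₂)`. -/
abbrev SmallUq : Type _ := Uq q ⧸ uqIdeal q n

/-- The quotient of `O_q(SL₂)` by `a ^ n - 1`, `b ^ n`, `c ^ n`, `d ^ n - 1`. -/
abbrev OqBar : Type _ := Oq q ⧸ oqIdeal q n

end Quotients

end QuantumSL2
namespace QuantumSL2

/-! ### `u_q(sl₂)` is finite-dimensional -/

theorem finite_of_relations {k A : Type*} [Field k] [Ring A] [Algebra k A] {e f g : A} {r s t : k}
    {n : ℕ} (hn : n ≠ 0) (hge : g * e = r • (e * g)) (hgf : g * f = s • (f * g))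
    (hfe : f * e = e * f - t • (g - g ^ (n - 1))) (hg : g ^ n = 1) (he : e ^ n = 0)
    (hf : f ^ n = 0) (h_adjoin : Algebra.adjoin k {e, f, g} = ⊤) : Module.Finite k A := by
  have comm {x y : A} {r : k} (h : y * x = r • (x * y)) (m : ℕ) :
      y * x ^ m = r ^ m • (x ^ m * y) := by
    induction m with
    | zero => simp
    | succ m ih => rw [pow_succ, ← mul_assoc, ih, smul_mul_assoc, mul_assoc, h, mul_smul_comm,
        smul_smul, mul_assoc, pow_succ]
  have comm' {x y : A} {r : k} (h : y * x = r • (x * y)) (m : ℕ) :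
      y ^ m * x = r ^ m • (x * y ^ m) := by
    induction m with
    | zero => simp
    | succ m ih => rw [pow_succ, mul_assoc, h, mul_smul_comm, ← mul_assoc, ih, smul_mul_assoc,
        smul_smul, mul_assoc, pow_succ, mul_comm]
  let M : ℕ → ℕ → ℕ → A := fun i j l => e ^ i * f ^ j * g ^ l
  let W : Submodule k A := Submodule.span k (Set.range fun p : ℕ × ℕ × ℕ => M p.1 p.2.1 p.2.2)
  have hM (i j l : ℕ) : M i j l ∈ W := Submodule.subset_span ⟨(i, j, l), rfl⟩
  have left (a : A) (h : ∀ i j l, a * M i j l ∈ W) (w : A) (hw : w ∈ W) : a * w ∈ W := by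
    induction hw using Submodule.span_induction with
    | mem x hx => obtain ⟨⟨i, j, l⟩, rfl⟩ := hx; exact h i j l
    | zero => simp
    | add x y _ _ hx hy => rw [mul_add]; exact W.add_mem hx hy
    | smul c x _ hx => rw [mul_smul_comm]; exact W.smul_mem _ hx
  have right (a : A) (h : ∀ i j l, M i j l * a ∈ W) (w : A) (hw : w ∈ W) : w * a ∈ W := by
    induction hw using Submodule.span_induction with
    | mem x hx => obtain ⟨⟨i, j, l⟩, rfl⟩ := hx; exact h i j l
    | zero => simp
    | add x y _ _ hx hy => rw [add_mul]; exact W.add_mem hx hy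
    | smul c x _ hx => rw [smul_mul_assoc]; exact W.smul_mem _ hx
  have left_e := left e fun i j l => by
    have : e * M i j l = M (i + 1) j l := by simp only [M, ← mul_assoc, ← pow_succ']
    rw [this]; exact hM _ _ _
  have left_g := left g fun i j l => by
    have : g * M i j l = (r ^ i * s ^ j) • M i j (l + 1) := by
      simp only [M, ← mul_assoc]
      rw [comm hge, smul_mul_assoc, smul_mul_assoc, mul_assoc (e ^ i) g, comm hgf, mul_smul_comm,
        smul_mul_assoc, smul_smul, ← mul_assoc, mul_assoc _ g, ← pow_succ']
    rw [this]; exact W.smul_mem _ (hM _ _ _)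
  have right_g := right g fun i j l => by
    have : M i j l * g = M i j (l + 1) := by simp only [M, mul_assoc, ← pow_succ]
    rw [this]; exact hM _ _ _
  have right_f := right f fun i j l => by
    have : M i j l * f = s ^ l • M i (j + 1) l := by
      simp only [M]
      rw [mul_assoc, comm' hgf, mul_smul_comm, pow_succ f, mul_assoc, mul_assoc, mul_assoc]
    rw [this]; exact W.smul_mem _ (hM _ _ _)
  have right_pow (a : A) (h : ∀ w ∈ W, w * a ∈ W) (m : ℕ) (w : A) (hw : w ∈ W) :
      w * a ^ m ∈ W := by
    induction m with
    | zero => simpa using hw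
    | succ m ih => rw [pow_succ, ← mul_assoc]; exact h _ ih
  have hfei (i : ℕ) : f * e ^ i ∈ W := by
    induction i with
    | zero => simpa [M] using hM 0 1 0
    | succ i ih =>
      rw [pow_succ', ← mul_assoc, hfe, sub_mul, mul_assoc]
      refine W.sub_mem (left_e _ ih) ?_
      rw [smul_mul_assoc, sub_mul]
      have hei : e ^ i ∈ W := by simpa [M] using hM i 0 0
      refine W.smul_mem _ (W.sub_mem (left_g _ hei) ?_)
      generalize n - 1 = m
      induction m with
      | zero => simpa using hei
      | succ m ihm => rw [pow_succ', mul_assoc]; exact left_g _ ihm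
  have left_f := left f fun i j l => by
    have : f * M i j l = f * e ^ i * f ^ j * g ^ l := by simp only [M, mul_assoc]
    rw [this]
    exact right_pow g right_g l _ (right_pow f right_f j _ (hfei i))
  have hall (a : A) : ∀ w ∈ W, a * w ∈ W := by
    have ha : a ∈ Algebra.adjoin k {e, f, g} := h_adjoin ▸ Algebra.mem_top
    induction ha using Algebra.adjoin_induction with
    | mem x hx => rcases hx with rfl | rfl | rfl <;> assumption
    | algebraMap c => intro w hw; rw [← Algebra.smul_def]; exact W.smul_mem _ hw
    | mul a b _ _ ha hb => intro w hw; rw [mul_assoc]; exact ha _ (hb _ hw)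
    | add a b _ _ ha hb => intro w hw; rw [add_mul]; exact W.add_mem (ha _ hw) (hb _ hw)
  have htop : W = ⊤ := by
    refine eq_top_iff.2 fun a _ => ?_
    have := hall a 1 (by simpa [M] using hM 0 0 0)
    rwa [mul_one] at this
  have hfin : (Set.range fun p : ℕ × ℕ × ℕ => M p.1 p.2.1 p.2.2).Finite := by
    refine Set.Finite.subset (Set.Finite.insert 0 (Set.Finite.image
      (fun p : ℕ × ℕ × ℕ => M p.1 p.2.1 p.2.2)
      (Finset.finite_toSet (Finset.range n ×ˢ Finset.range n ×ˢ Finset.range n)))) ?_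
    rintro _ ⟨⟨i, j, l⟩, rfl⟩
    by_cases hi : n ≤ i
    · left; simp [M, pow_eq_zero_of_le hi he]
    by_cases hj : n ≤ j
    · left; simp [M, pow_eq_zero_of_le hj hf]
    right
    refine ⟨(i, j, l % n), ?_, ?_⟩
    · simp only [Finset.coe_product, Set.mem_prod, Finset.mem_coe, Finset.mem_range]
      exact ⟨by omega, by omega, Nat.mod_lt _ (Nat.pos_of_ne_zero hn)⟩
    · simp only [M]
      rw [← pow_eq_pow_mod l hg]
  exact ⟨htop ▸ Submodule.fg_span hfin⟩

variable {k : Type*} [Field k] (q : kˣ) (n : ℕ)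

theorem SmallUq.pow_eq :
    Ideal.Quotient.mkₐ k (uqIdeal q n) (Uq.K q) ^ n = 1 ∧
    Ideal.Quotient.mkₐ k (uqIdeal q n) (Uq.E q) ^ n = 0 ∧
    Ideal.Quotient.mkₐ k (uqIdeal q n) (Uq.F q) ^ n = 0 := by
  have hK := mk_of_mem (k := k)
    (s := {Uq.K q ^ n - 1, Uq.E q ^ n, Uq.F q ^ n}) (x := Uq.K q ^ n - 1) (by simp)
  have hE := mk_of_mem (k := k)
    (s := {Uq.K q ^ n - 1, Uq.E q ^ n, Uq.F q ^ n}) (x := Uq.E q ^ n) (by simp)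
  have hF := mk_of_mem (k := k)
    (s := {Uq.K q ^ n - 1, Uq.E q ^ n, Uq.F q ^ n}) (x := Uq.F q ^ n) (by simp)
  rw [map_sub, map_one, sub_eq_zero, map_pow] at hK
  rw [map_pow] at hE hF
  exact ⟨hK, hE, hF⟩

instance [h : OddPrimitiveRoot q n] : Module.Finite k (SmallUq q n) := by
  obtain ⟨hK, hE, hF⟩ := SmallUq.pow_eq q n
  have hn := h.ne_zero
  set π := Ideal.Quotient.mkₐ k (uqIdeal q n) with hπ
  have hinv : π (Uq.Kinv q) = π (Uq.K q) ^ (n - 1) := by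
    have h1 : π (Uq.Kinv q) * π (Uq.K q) ^ n = π (Uq.Kinv q) := by rw [hK, mul_one]
    rw [← h1, ← mul_pow_sub_one hn (π (Uq.K q)), ← mul_assoc, ← map_mul, Uq.Kinv_mul_K, map_one, one_mul]
  refine finite_of_relations (e := π (Uq.E q)) (f := π (Uq.F q)) (g := π (Uq.K q))
    (r := (q : k) ^ 2) (s := ((q : k) ^ 2)⁻¹) (t := ((q : k) - (q : k)⁻¹)⁻¹) hn ?_ ?_ ?_ hK hE hF ?_
  · rw [← map_mul, Uq.K_mul_E, map_smul, map_mul]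
  · rw [← map_mul, Uq.K_mul_F, map_smul, map_mul]
  · rw [← hinv, ← map_sub, ← map_smul, ← Uq.E_mul_F_sub, map_sub, map_mul, map_mul]
    abel
  · refine eq_top_iff.2 ?_
    have h1 : (⊤ : Subalgebra k (SmallUq q n)) = (Algebra.adjoin k (Set.range (Uq.gen q))).map π := by
      rw [Uq.adjoin_gen, Algebra.map_top, eq_comm, AlgHom.range_eq_top]
      exact Ideal.Quotient.mk_surjective
    rw [h1, AlgHom.map_adjoin, Algebra.adjoin_le_iff]
    rintro _ ⟨_, ⟨x, rfl⟩, rfl⟩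
    cases x with
    | E => exact Algebra.subset_adjoin (by simp)
    | F => exact Algebra.subset_adjoin (by simp)
    | K => exact Algebra.subset_adjoin (by simp)
    | Kinv =>
      change π (Uq.Kinv q) ∈ _
      rw [hinv]
      exact Subalgebra.pow_mem _ (Algebra.subset_adjoin (by simp)) _

end QuantumSL2
/-! ### Dualities of Hopf algebras -/

section Duality

variable {k H L : Type*} [Field k] [Ring H] [HopfAlgebra k H] [Ring L] [HopfAlgebra k L]

/-- The bilinear form `⟨ , ⟩` realizes a duality between the Hopf algebras `H` and `L`. -/
structure IsHopfDuality (B : H →ₗ[k] L →ₗ[k] k) : Prop where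
  /-- `⟨uv, x⟩ = ⟨u, x₁⟩⟨v, x₂⟩` -/
  mul_left : ∀ (u v : H) (x : L),
    B (u * v) x = LinearMap.mul' k k (TensorProduct.map (B u) (B v) (comul x))
  /-- `⟨u, xy⟩ = ⟨u₁, x⟩⟨u₂, y⟩` -/
  mul_right : ∀ (u : H) (x y : L),
    B u (x * y) = LinearMap.mul' k k (TensorProduct.map (B.flip x) (B.flip y) (comul u))
  /-- `⟨1, x⟩ = ε(x)` -/
  one_left : ∀ x : L, B 1 x = counit (R := k) x
  /-- `⟨u, 1⟩ = ε(u)` -/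
  one_right : ∀ u : H, B u 1 = counit (R := k) u
  /-- `⟨S(u), x⟩ = ⟨u, S(x)⟩` -/
  antipode : ∀ (u : H) (x : L),
    B (HopfAlgebra.antipode k u) x = B u (HopfAlgebra.antipode k x)

/-- A duality is perfect if both induced maps `H → L*` and `L → H*` are injective. -/
structure IsPerfectHopfDuality (B : H →ₗ[k] L →ₗ[k] k) : Prop extends IsHopfDuality B where
  injective_left : Function.Injective B
  injective_right : Function.Injective B.flip

end Duality

namespace QuantumSL2

/-! ### Matrix coefficients of a two-dimensional representation -/

section Coefficients

variable {k H : Type*} [Field k] [Ring H] [HopfAlgebra k H]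

/-- The matrix coefficient `x ↦ R(x)ᵢⱼ`. -/
def coeff (R : H →ₐ[k] Matrix (Fin 2) (Fin 2) k) (i j : Fin 2) : HopfDual k H :=
  (HopfDual.toDual k H).symm (Matrix.entryLinearMap k k i j ∘ₗ R.toLinearMap)

theorem coeff_apply (R : H →ₐ[k] Matrix (Fin 2) (Fin 2) k) (i j : Fin 2) (x : H) :
    coeff R i j x = R x i j := rfl

/-- The functionals `A`, `B`, `C`, `D` with `R(x) = !![A(x), B(x); C(x), D(x)]`. -/
def coeffGen (R : H →ₐ[k] Matrix (Fin 2) (Fin 2) k) : OqGen → HopfDual k H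
  | .a => coeff R 0 0
  | .b => coeff R 0 1
  | .c => coeff R 1 0
  | .d => coeff R 1 1

theorem coeff_mul_apply_mul (R : H →ₐ[k] Matrix (Fin 2) (Fin 2) k) (i j l m : Fin 2) (x y : H) :
    (coeff R i l * coeff R j m) (x * y) =
      ∑ p, ∑ r, (coeff R i p * coeff R j r) x * (coeff R p l * coeff R r m) y := by
  simp only [HopfDual.mul_apply, Bialgebra.comul_mul]
  generalize (comul x : H ⊗[k] H) = s
  generalize (comul y : H ⊗[k] H) = t
  induction s with
  | zero => simp
  | add s₁ s₂ h₁ h₂ => rw [add_mul, map_add, map_add, h₁, h₂]; simp only [map_add, add_mul,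
      Finset.sum_add_distrib]
  | tmul s₁ s₂ =>
    induction t with
    | zero => simp
    | add t₁ t₂ h₁ h₂ => rw [mul_add, map_add, map_add, h₁, h₂]; simp only [map_add, mul_add,
        Finset.sum_add_distrib]
    | tmul t₁ t₂ =>
      simp only [Algebra.TensorProduct.tmul_mul_tmul, TensorProduct.map_tmul, LinearMap.mul'_apply,
        HopfDual.toDual_apply, coeff_apply, map_mul, Matrix.mul_apply, Fin.sum_univ_two]
      ring

/-- The coefficients of the vector `v₁ ⊗ v₀ - q v₀ ⊗ v₁`. -/
def invVec (q : kˣ) : Fin 2 → Fin 2 → k := ![![0, -q], ![1, 0]]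

/-- The vector `invVec q` and the covector with the same coefficients are invariant under `x`. -/
def Fixes (q : kˣ) (R : H →ₐ[k] Matrix (Fin 2) (Fin 2) k) (x : H) : Prop :=
  (∀ i j, ∑ l, ∑ m, invVec q l m * (coeff R i l * coeff R j m) x =
    counit (R := k) x * invVec q i j) ∧
  (∀ l m, ∑ i, ∑ j, invVec q i j * (coeff R i l * coeff R j m) x =
    counit (R := k) x * invVec q l m)

theorem Fixes.mul {q : kˣ} {R : H →ₐ[k] Matrix (Fin 2) (Fin 2) k} {x y : H} (hx : Fixes q R x)
    (hy : Fixes q R y) : Fixes q R (x * y) := by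
  refine ⟨fun i j => ?_, fun l m => ?_⟩
  · have h := hx.1 i j
    have h00 := hy.1 0 0
    have h01 := hy.1 0 1
    have h10 := hy.1 1 0
    have h11 := hy.1 1 1
    simp only [coeff_mul_apply_mul, Bialgebra.counit_mul, Fin.sum_univ_two] at *
    linear_combination (coeff R i 0 * coeff R j 0) x * h00 + (coeff R i 0 * coeff R j 1) x * h01 +
      (coeff R i 1 * coeff R j 0) x * h10 + (coeff R i 1 * coeff R j 1) x * h11 +
      counit (R := k) y * h
  · have h := hy.2 l m
    have h00 := hx.2 0 0
    have h01 := hx.2 0 1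
    have h10 := hx.2 1 0
    have h11 := hx.2 1 1
    simp only [coeff_mul_apply_mul, Bialgebra.counit_mul, Fin.sum_univ_two] at *
    linear_combination (coeff R 0 l * coeff R 0 m) y * h00 + (coeff R 0 l * coeff R 1 m) y * h01 +
      (coeff R 1 l * coeff R 0 m) y * h10 + (coeff R 1 l * coeff R 1 m) y * h11 +
      counit (R := k) x * h

theorem Fixes.add {q : kˣ} {R : H →ₐ[k] Matrix (Fin 2) (Fin 2) k} {x y : H} (hx : Fixes q R x)
    (hy : Fixes q R y) : Fixes q R (x + y) := by
  refine ⟨fun i j => ?_, fun l m => ?_⟩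
  · simp only [map_add, mul_add, add_mul, Finset.sum_add_distrib, hx.1, hy.1]
  · simp only [map_add, mul_add, add_mul, Finset.sum_add_distrib, hx.2, hy.2]

theorem Fixes.scalar {q : kˣ} {R : H →ₐ[k] Matrix (Fin 2) (Fin 2) k} (c : k) :
    Fixes q R (algebraMap k H c) := by
  have h (i l j m : Fin 2) : (coeff R i l * coeff R j m) (algebraMap k H c) =
      c * ((1 : Matrix (Fin 2) (Fin 2) k) i l * (1 : Matrix (Fin 2) (Fin 2) k) j m) := by
    rw [Algebra.algebraMap_eq_smul_one, map_smul, HopfDual.mul_apply, Bialgebra.comul_one,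
      Algebra.TensorProduct.one_def, TensorProduct.map_tmul, LinearMap.mul'_apply,
      HopfDual.toDual_apply, HopfDual.toDual_apply, coeff_apply, coeff_apply, map_one, smul_eq_mul]
  refine ⟨fun i j => ?_, fun i j => ?_⟩ <;> fin_cases i <;> fin_cases j <;>
    simp [h, invVec, Fin.sum_univ_two, mul_comm]

theorem coeffGen_rel {q : kˣ} {R : H →ₐ[k] Matrix (Fin 2) (Fin 2) k} (h : ∀ x, Fixes q R x) :
    (coeffGen R .b * coeffGen R .a = (q : k) • (coeffGen R .a * coeffGen R .b)) ∧
    (coeffGen R .c * coeffGen R .a = (q : k) • (coeffGen R .a * coeffGen R .c)) ∧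
    (coeffGen R .d * coeffGen R .b = (q : k) • (coeffGen R .b * coeffGen R .d)) ∧
    (coeffGen R .d * coeffGen R .c = (q : k) • (coeffGen R .c * coeffGen R .d)) ∧
    (coeffGen R .b * coeffGen R .c = coeffGen R .c * coeffGen R .b) ∧
    (coeffGen R .a * coeffGen R .d = (q : k)⁻¹ • (coeffGen R .b * coeffGen R .c) + 1) ∧
    (coeffGen R .d * coeffGen R .a = (q : k) • (coeffGen R .b * coeffGen R .c) + 1) := by
  have hq : (q : k) ≠ 0 := q.ne_zero
  have h₁ (i j x) := (h x).1 i j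
  have h₂ (i j x) := (h x).2 i j
  simp only [Fin.sum_univ_two] at h₁ h₂
  have e₁ (x) := h₁ 0 0 x
  have e₂ (x) := h₂ 0 0 x
  have e₃ (x) := h₁ 1 1 x
  have e₄ (x) := h₂ 1 1 x
  have e₅ (x) := h₁ 0 1 x
  have e₆ (x) := h₂ 0 1 x
  have e₇ (x) := h₁ 1 0 x
  simp [invVec] at e₁ e₂ e₃ e₄ e₅ e₆ e₇
  refine ⟨?_, ?_, ?_, ?_, ?_, ?_, ?_⟩ <;> refine HopfDual.ext fun x => ?_ <;>
    simp only [coeffGen, HopfDual.smul_apply, HopfDual.add_apply, HopfDual.one_apply]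
  · linear_combination e₁ x
  · linear_combination e₂ x
  · linear_combination e₄ x
  · linear_combination e₃ x
  · linear_combination e₅ x - e₆ x
  · field_simp
    linear_combination -e₅ x
  · linear_combination e₇ x + (q : k) * (e₆ x - e₅ x)

theorem coeff_comul [Module.Finite k H] (R : H →ₐ[k] Matrix (Fin 2) (Fin 2) k) (i j : Fin 2) :
    comul (R := k) (coeff R i j) = ∑ l, coeff R i l ⊗ₜ[k] coeff R l j := by
  refine HopfDual.tensorEquiv_ext fun x y => ?_
  rw [HopfDual.tensorEquiv_comul, LinearMap.mul'_apply, map_sum, LinearMap.sum_apply]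
  simp only [HopfDual.tensorEquiv_tmul, coeff_apply, map_mul, Matrix.mul_apply]

end Coefficients

/-! ### The pairing map `φ` -/

section Phi

variable {k : Type*} [Field k] (q : kˣ) (n : ℕ)

/-- The matrices of the generators on the module `V_{1,1}`. -/
def rhoGen : UqGen → Matrix (Fin 2) (Fin 2) k
  | .E => !![0, 1; 0, 0]
  | .F => !![0, 0; 1, 0]
  | .K => !![(q : k), 0; 0, (q : k)⁻¹]
  | .Kinv => !![(q : k)⁻¹, 0; 0, (q : k)]

/-- The two-dimensional representation `ρ` of `U_q(sl₂)` on `V_{1,1}`. -/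
def rho [OddPrimitiveRoot q n] : Uq q →ₐ[k] Matrix (Fin 2) (Fin 2) k :=
  Uq.lift q (rhoGen q)
    (by simp [rhoGen, Matrix.one_fin_two])
    (by simp [rhoGen, Matrix.one_fin_two])
    (by simp [rhoGen, pow_two])
    (by simp [rhoGen, pow_two])
    (by
      rw [eq_inv_smul_iff₀ (OddPrimitiveRoot.sub_inv_ne_zero n)]
      simp [rhoGen])

theorem rho_gen [OddPrimitiveRoot q n] (x : UqGen) : rho q n (Uq.gen q x) = rhoGen q x :=
  Uq.lift_gen ..

theorem fixes_rho [OddPrimitiveRoot q n] (x : Uq q) : Fixes q (rho q n) x := by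
  have hq : (q : k) ≠ 0 := q.ne_zero
  have hx : x ∈ Algebra.adjoin k (Set.range (Uq.gen q)) := by
    rw [Uq.adjoin_gen]; exact Algebra.mem_top
  induction hx using Algebra.adjoin_induction with
  | algebraMap c => exact Fixes.scalar c
  | mul a b _ _ ha hb => exact ha.mul hb
  | add a b _ _ ha hb => exact ha.add hb
  | mem x hx =>
    obtain ⟨x, rfl⟩ := hx
    refine ⟨fun i j => ?_, fun i j => ?_⟩ <;> fin_cases i <;> fin_cases j <;> cases x <;>
      simp [HopfDual.mul_apply, Uq.comul_gen, Uq.comulGen, Uq.counit_gen, Uq.counitGen,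
        coeff_apply, rho_gen, rhoGen, invVec, hq]

/-- The algebra map `φ : O_q(SL₂) → U_q(sl₂)*` with `a, b, c, d ↦ A, B, C, D`. -/
def phi [OddPrimitiveRoot q n] : Oq q →ₐ[k] HopfDual k (Uq q) :=
  Oq.lift q (coeffGen (rho q n)) (coeffGen_rel (fixes_rho q n)).1
    (coeffGen_rel (fixes_rho q n)).2.1 (coeffGen_rel (fixes_rho q n)).2.2.1
    (coeffGen_rel (fixes_rho q n)).2.2.2.1 (coeffGen_rel (fixes_rho q n)).2.2.2.2.1
    (coeffGen_rel (fixes_rho q n)).2.2.2.2.2.1 (coeffGen_rel (fixes_rho q n)).2.2.2.2.2.2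

theorem phi_gen [OddPrimitiveRoot q n] (x : OqGen) :
    phi q n (Oq.gen q x) = coeffGen (rho q n) x := Oq.lift_gen ..

/-- The representation `ρ` factors through `u_q(sl₂)`. -/
def rhoSmall [h : OddPrimitiveRoot q n] : SmallUq q n →ₐ[k] Matrix (Fin 2) (Fin 2) k :=
  Ideal.Quotient.liftₐ (uqIdeal q n) (rho q n) (by
    have hn := h.three_le
    have hpow : (q : k) ^ n = 1 := h.isPrimitiveRoot.pow_eq_one
    have hle : TwoSidedIdeal.span {Uq.K q ^ n - 1, Uq.E q ^ n, Uq.F q ^ n} ≤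
        TwoSidedIdeal.ker (rho q n) := by
      refine TwoSidedIdeal.span_le.2 ?_
      obtain ⟨m, rfl⟩ : ∃ m, n = m + 2 := ⟨n - 2, by omega⟩
      rintro _ (rfl | rfl | rfl) <;> refine (TwoSidedIdeal.mem_ker _).2 ?_
      · have hd : rhoGen q .K = Matrix.diagonal ![(q : k), (q : k)⁻¹] := by
          ext i j; fin_cases i <;> fin_cases j <;> simp [rhoGen]
        rw [map_sub, map_one, map_pow, rho_gen, hd, Matrix.diagonal_pow, sub_eq_zero,
          ← Matrix.diagonal_one]
        congr 1
        ext i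
        fin_cases i <;> simp [hpow]
      · have h0 : rhoGen q .E * rhoGen q .E = 0 := by
          ext i j; fin_cases i <;> fin_cases j <;> simp [rhoGen]
        rw [map_pow, rho_gen, pow_add, pow_two, h0, mul_zero]
      · have h0 : rhoGen q .F * rhoGen q .F = 0 := by
          ext i j; fin_cases i <;> fin_cases j <;> simp [rhoGen]
        rw [map_pow, rho_gen, pow_add, pow_two, h0, mul_zero]
    intro x hx
    exact (TwoSidedIdeal.mem_ker _).1 (hle hx))

theorem rhoSmall_mk [OddPrimitiveRoot q n] (x : Uq q) :
    rhoSmall q n (Ideal.Quotient.mk _ x) = rho q n x := rfl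

theorem mul_apply_mk [OddPrimitiveRoot q n] (f g : HopfDual k (SmallUq q n))
    (f' g' : HopfDual k (Uq q)) (hf : ∀ x, f (Ideal.Quotient.mk _ x) = f' x)
    (hg : ∀ x, g (Ideal.Quotient.mk _ x) = g' x) (x : Uq q) :
    (f * g) (Ideal.Quotient.mk _ x) = (f' * g') x := by
  rw [HopfDual.mul_apply, HopfDual.mul_apply, Bialgebra.Quotient.comul_mk]
  generalize (comul x : Uq q ⊗[k] Uq q) = s
  induction s with
  | zero => simp
  | add s₁ s₂ h₁ h₂ => simp only [map_add, h₁, h₂]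
  | tmul s₁ s₂ => simp [hf, hg]

theorem fixes_rhoSmall [OddPrimitiveRoot q n] (x : SmallUq q n) : Fixes q (rhoSmall q n) x := by
  obtain ⟨x, rfl⟩ := Ideal.Quotient.mk_surjective x
  have h (i j l m) : (coeff (rhoSmall q n) i j * coeff (rhoSmall q n) l m)
      (Ideal.Quotient.mk _ x) = (coeff (rho q n) i j * coeff (rho q n) l m) x :=
    mul_apply_mk q n _ _ _ _ (fun _ => rfl) (fun _ => rfl) x
  have hx := fixes_rho q n x
  simp only [Fixes, h, Bialgebra.Quotient.counit_mk]
  exact hx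

/-- The algebra map `O_q(SL₂) → u_q(sl₂)*` with `a, b, c, d ↦ A, B, C, D`. -/
def phiSmallHom [OddPrimitiveRoot q n] : Oq q →ₐ[k] HopfDual k (SmallUq q n) :=
  Oq.lift q (coeffGen (rhoSmall q n)) (coeffGen_rel (fixes_rhoSmall q n)).1
    (coeffGen_rel (fixes_rhoSmall q n)).2.1 (coeffGen_rel (fixes_rhoSmall q n)).2.2.1
    (coeffGen_rel (fixes_rhoSmall q n)).2.2.2.1 (coeffGen_rel (fixes_rhoSmall q n)).2.2.2.2.1
    (coeffGen_rel (fixes_rhoSmall q n)).2.2.2.2.2.1 (coeffGen_rel (fixes_rhoSmall q n)).2.2.2.2.2.2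

theorem phiSmallHom_gen [OddPrimitiveRoot q n] (x : OqGen) :
    phiSmallHom q n (Oq.gen q x) = coeffGen (rhoSmall q n) x := Oq.lift_gen ..

/-- The bialgebra map `O_q(SL₂) → u_q(sl₂)*` with `a, b, c, d ↦ A, B, C, D`. -/
def phiSmall [OddPrimitiveRoot q n] : Oq q →ₐc[k] HopfDual k (SmallUq q n) :=
  .ofAlgHom (phiSmallHom q n)
    (Oq.algHom_ext fun x => by
      change counit (R := k) (phiSmallHom q n (Oq.gen q x)) = counit (R := k) (Oq.gen q x)
      rw [phiSmallHom_gen, HopfDual.counit_apply, Oq.counit_gen]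
      cases x <;> simp [coeffGen, coeff_apply, Oq.counitGen])
    (Oq.algHom_ext fun x => by
      change Algebra.TensorProduct.map (phiSmallHom q n) (phiSmallHom q n)
        (comul (R := k) (Oq.gen q x)) = comul (R := k) (phiSmallHom q n (Oq.gen q x))
      rw [phiSmallHom_gen, Oq.comul_gen]
      cases x <;> simp [coeffGen, Oq.comulGen, coeff_comul, phiSmallHom_gen])

theorem phiSmall_gen [OddPrimitiveRoot q n] (x : OqGen) :
    phiSmall q n (Oq.gen q x) = coeffGen (rhoSmall q n) x := phiSmallHom_gen q n x

theorem phiSmall_apply_mul [OddPrimitiveRoot q n] {u u₁ u₂ v₁ v₂ : Oq q}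
    (h : comul (R := k) u = u₁ ⊗ₜ u₂ + v₁ ⊗ₜ v₂) (x y : SmallUq q n) :
    phiSmall q n u (x * y) =
      phiSmall q n u₁ x * phiSmall q n u₂ y + phiSmall q n v₁ x * phiSmall q n v₂ y := by
  have := HopfDual.tensorEquiv_comul (phiSmall q n u) (x ⊗ₜ[k] y)
  rw [LinearMap.mul'_apply, ← CoalgHomClass.map_comp_comul_apply, h, map_add,
    TensorProduct.map_tmul, TensorProduct.map_tmul, map_add, LinearMap.add_apply,
    HopfDual.tensorEquiv_tmul, HopfDual.tensorEquiv_tmul] at this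
  exact this.symm

/-- `a ^ n`, `b ^ n`, `c ^ n`, `d ^ n` pair with `x` as the entries of `ε(x)` times the identity. -/
def PowTrivial [OddPrimitiveRoot q n] (x : SmallUq q n) : Prop :=
  phiSmall q n (Oq.a q ^ n) x = counit (R := k) x ∧ phiSmall q n (Oq.b q ^ n) x = 0 ∧
  phiSmall q n (Oq.c q ^ n) x = 0 ∧ phiSmall q n (Oq.d q ^ n) x = counit (R := k) x

theorem pow_apply_gen [OddPrimitiveRoot q n] (u : OqGen) (x : UqGen) (m : ℕ) :
    ((coeffGen (rhoSmall q n) u) ^ (m + 1)) (Ideal.Quotient.mk _ (Uq.gen q x)) =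
    match x with
    | .E => ((coeffGen (rhoSmall q n) u) ^ m) 1 * coeffGen (rho q n) u (Uq.E q) +
        ((coeffGen (rhoSmall q n) u) ^ m) (Ideal.Quotient.mk _ (Uq.E q)) *
          coeffGen (rho q n) u (Uq.K q)
    | .F => ((coeffGen (rhoSmall q n) u) ^ m) (Ideal.Quotient.mk _ (Uq.Kinv q)) *
          coeffGen (rho q n) u (Uq.F q) +
        ((coeffGen (rhoSmall q n) u) ^ m) (Ideal.Quotient.mk _ (Uq.F q)) *
          coeffGen (rho q n) u 1
    | .K => ((coeffGen (rhoSmall q n) u) ^ m) (Ideal.Quotient.mk _ (Uq.K q)) *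
          coeffGen (rho q n) u (Uq.K q)
    | .Kinv => ((coeffGen (rhoSmall q n) u) ^ m) (Ideal.Quotient.mk _ (Uq.Kinv q)) *
          coeffGen (rho q n) u (Uq.Kinv q) := by
  have hc (y : Uq q) : coeffGen (rhoSmall q n) u (Ideal.Quotient.mk _ y) =
      coeffGen (rho q n) u y := by cases u <;> rfl
  rw [pow_succ, HopfDual.mul_apply, Bialgebra.Quotient.comul_mk, Uq.comul_gen]
  cases x <;> simp [Uq.comulGen, hc, ← hc 1]

theorem pow_apply_one [OddPrimitiveRoot q n] (f : HopfDual k (SmallUq q n)) (m : ℕ) :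
    (f ^ m) 1 = f 1 ^ m := by
  induction m with
  | zero => simp [HopfDual.one_apply]
  | succ m ih => rw [pow_succ, pow_succ, HopfDual.mul_apply, Bialgebra.comul_one,
      Algebra.TensorProduct.one_def, TensorProduct.map_tmul, LinearMap.mul'_apply,
      HopfDual.toDual_apply, HopfDual.toDual_apply, ih]

theorem one_apply_gen [OddPrimitiveRoot q n] (x : UqGen) :
    (1 : HopfDual k (SmallUq q n)) (Ideal.Quotient.mk _ (Uq.gen q x)) = Uq.counitGen x := by
  rw [HopfDual.one_apply, Bialgebra.Quotient.counit_mk, Uq.counit_gen]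

theorem powTrivial_gen [h : OddPrimitiveRoot q n] (x : UqGen) :
    PowTrivial q n (Ideal.Quotient.mk _ (Uq.gen q x)) := by
  have hpow : (q : k) ^ n = 1 := h.isPrimitiveRoot.pow_eq_one
  have hA (m : ℕ) : ∀ x : UqGen, ((coeffGen (rhoSmall q n) .a) ^ m)
      (Ideal.Quotient.mk _ (Uq.gen q x)) =
      match x with | .E => 0 | .F => 0 | .K => (q : k) ^ m | .Kinv => ((q : k)⁻¹) ^ m := by
    induction m with
    | zero => intro x; cases x <;> simp [one_apply_gen, Uq.counitGen]
    | succ m ih =>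
      intro x
      have hE := ih .E
      have hF := ih .F
      have hK := ih .K
      have hKinv := ih .Kinv
      rw [pow_apply_gen]
      simp only [coeffGen] at hE hF hK hKinv ⊢
      cases x <;> simp [hE, hF, hK, hKinv, coeff_apply, rho_gen, rhoGen, pow_succ, mul_comm]
  have hD (m : ℕ) : ∀ x : UqGen, ((coeffGen (rhoSmall q n) .d) ^ m)
      (Ideal.Quotient.mk _ (Uq.gen q x)) =
      match x with | .E => 0 | .F => 0 | .K => ((q : k)⁻¹) ^ m | .Kinv => (q : k) ^ m := by
    induction m with
    | zero => intro x; cases x <;> simp [one_apply_gen, Uq.counitGen]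
    | succ m ih =>
      intro x
      have hE := ih .E
      have hF := ih .F
      have hK := ih .K
      have hKinv := ih .Kinv
      rw [pow_apply_gen]
      simp only [coeffGen] at hE hF hK hKinv ⊢
      cases x <;> simp [hE, hF, hK, hKinv, coeff_apply, rho_gen, rhoGen, pow_succ, mul_comm]
  have hB (m : ℕ) (x : UqGen) : ((coeffGen (rhoSmall q n) .b) ^ (m + 2))
      (Ideal.Quotient.mk _ (Uq.gen q x)) = 0 := by
    rw [pow_apply_gen]
    cases x <;> simp [pow_apply_one, coeffGen, coeff_apply, rho_gen, rhoGen]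
  have hC (m : ℕ) (x : UqGen) : ((coeffGen (rhoSmall q n) .c) ^ (m + 2))
      (Ideal.Quotient.mk _ (Uq.gen q x)) = 0 := by
    have hK := pow_apply_gen q n .c .Kinv m
    rw [pow_apply_gen]
    simp only [coeffGen] at hK ⊢
    simp only [coeff_apply, rho_gen, rhoGen] at hK
    simp only [Matrix.of_apply, Matrix.cons_val', Matrix.cons_val_zero, Matrix.cons_val_one,
      Matrix.cons_val_fin_one, mul_zero] at hK
    cases x <;> simp [hK, pow_apply_one, coeff_apply, rho_gen, rhoGen]
  obtain ⟨m, hm⟩ : ∃ m, n = m + 2 := ⟨n - 2, by have := h.three_le; omega⟩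
  refine ⟨?_, ?_, ?_, ?_⟩ <;> rw [map_pow, phiSmall_gen]
  · rw [hA, Bialgebra.Quotient.counit_mk, Uq.counit_gen]
    cases x <;> simp [Uq.counitGen, hpow]
  · have := hB m x
    rwa [← hm] at this
  · have := hC m x
    rwa [← hm] at this
  · rw [hD, Bialgebra.Quotient.counit_mk, Uq.counit_gen]
    cases x <;> simp [Uq.counitGen, hpow]

theorem powTrivial [h : OddPrimitiveRoot q n] (x : SmallUq q n) : PowTrivial q n x := by
  obtain ⟨x, rfl⟩ := Ideal.Quotient.mk_surjective x
  have hx : x ∈ Algebra.adjoin k (Set.range (Uq.gen q)) := by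
    rw [Uq.adjoin_gen]; exact Algebra.mem_top
  induction hx using Algebra.adjoin_induction with
  | mem x hx => obtain ⟨x, rfl⟩ := hx; exact powTrivial_gen q n x
  | algebraMap c =>
    have hn := h.ne_zero
    have e : Ideal.Quotient.mk (uqIdeal q n) (algebraMap k _ c) = c • (1 : SmallUq q n) := by
      rw [← Algebra.algebraMap_eq_smul_one]; rfl
    rw [e]
    refine ⟨?_, ?_, ?_, ?_⟩ <;> rw [map_pow, phiSmall_gen, map_smul, pow_apply_one] <;>
      simp [coeffGen, coeff_apply, hn]
  | mul a b _ _ ha hb =>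
    obtain ⟨h₁, h₂, h₃, h₄⟩ := Oq.comul_pow_gen q n
    obtain ⟨ha₁, ha₂, ha₃, ha₄⟩ := ha
    obtain ⟨hb₁, hb₂, hb₃, hb₄⟩ := hb
    rw [map_mul]
    refine ⟨?_, ?_, ?_, ?_⟩
    · rw [phiSmall_apply_mul q n h₁, ha₁, hb₁, ha₂, zero_mul, add_zero, Bialgebra.counit_mul]
    · rw [phiSmall_apply_mul q n h₂, hb₂, ha₂, mul_zero, zero_mul, add_zero]
    · rw [phiSmall_apply_mul q n h₃, ha₃, hb₃, mul_zero, zero_mul, add_zero]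
    · rw [phiSmall_apply_mul q n h₄, ha₃, ha₄, hb₄, zero_mul, zero_add, Bialgebra.counit_mul]
  | add a b _ _ ha hb =>
    obtain ⟨ha₁, ha₂, ha₃, ha₄⟩ := ha
    obtain ⟨hb₁, hb₂, hb₃, hb₄⟩ := hb
    rw [map_add]
    exact ⟨by rw [map_add, map_add, ha₁, hb₁], by rw [map_add, ha₂, hb₂, add_zero],
      by rw [map_add, ha₃, hb₃, add_zero], by rw [map_add, map_add, ha₄, hb₄]⟩

theorem phiSmallHom_eq_zero [OddPrimitiveRoot q n] (u : Oq q) (hu : u ∈ oqIdeal q n) :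
    phiSmallHom q n u = 0 := by
  have hle : TwoSidedIdeal.span {Oq.a q ^ n - 1, Oq.b q ^ n, Oq.c q ^ n, Oq.d q ^ n - 1} ≤
      TwoSidedIdeal.ker (phiSmallHom q n) := by
    refine TwoSidedIdeal.span_le.2 ?_
    rintro _ (rfl | rfl | rfl | rfl) <;> refine (TwoSidedIdeal.mem_ker _).2 ?_
    · rw [map_sub, map_one, sub_eq_zero]
      exact HopfDual.ext fun x => (powTrivial q n x).1
    · exact HopfDual.ext fun x => (powTrivial q n x).2.1
    · exact HopfDual.ext fun x => (powTrivial q n x).2.2.1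
    · rw [map_sub, map_one, sub_eq_zero]
      exact HopfDual.ext fun x => (powTrivial q n x).2.2.2
  exact (TwoSidedIdeal.mem_ker _).1 (hle hu)

/-- The induced map `φ̄` from the quotient of `O_q(SL₂)` to `u_q(sl₂)*`, a bialgebra map. -/
def phiBar [OddPrimitiveRoot q n] : OqBar q n →ₐc[k] HopfDual k (SmallUq q n) :=
  .ofAlgHom (Ideal.Quotient.liftₐ (oqIdeal q n) (phiSmallHom q n) (phiSmallHom_eq_zero q n))
    (Ideal.Quotient.algHom_ext k (BialgHom.counitAlgHom_comp (phiSmall q n)))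
    (Ideal.Quotient.algHom_ext k (by
      have h := BialgHom.map_comp_comulAlgHom (phiSmall q n)
      refine AlgHom.ext fun u => Eq.trans ?_ (AlgHom.congr_fun h u)
      change Algebra.TensorProduct.map _ _ (TensorProduct.map _ _ (comul (R := k) u)) =
        Algebra.TensorProduct.map _ _ (comul (R := k) u)
      generalize (comul u : Oq q ⊗[k] Oq q) = s
      induction s with
      | zero => simp
      | add s₁ s₂ h₁ h₂ => simp only [map_add, h₁, h₂]
      | tmul s₁ s₂ => rfl))

/-- The bilinear form `⟨u, x⟩ = φ̄(u)(x)`. -/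
def pairing [OddPrimitiveRoot q n] : OqBar q n →ₗ[k] SmallUq q n →ₗ[k] k :=
  (HopfDual.toDual k (SmallUq q n)).toLinearMap ∘ₗ
    ((phiBar q n : OqBar q n →ₐ[k] HopfDual k (SmallUq q n)).toLinearMap)

end Phi

end QuantumSL2

end

/-!
The pairing is computed on explicit monomials. Let `A`, `B`, `C`, `D` be the matrix coefficients of
the two-dimensional representation. For the regular actions of `u_q(sl₂)` on its dual, `E ⇀` and
`↼ F` are skew derivations (`HopfDual.leftAct_mul`, `HopfDual.rightAct_mul`): the first kills `A`
and `C` and maps `B` to `A`, the second kills `A` and `B` and maps `C` to `A`. Hence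
`E ⇀ C ^ l A ^ i B ^ j = [j] C ^ l A ^ (i + 1) B ^ (j - 1)`, symmetrically for `F` and `C`, and since
`B` and `C` vanish on powers of `K`,

`⟨c ^ l a ^ i b ^ j, F ^ r K ^ s E ^ t⟩ = δ_{r l} δ_{t j} [l]! [j]! q ^ (s (i + j + l))`

(`mono_apply`). For exponents below `n` the quantum factorials do not vanish, and each diagonal
block is, up to a scalar for each row, the Vandermonde matrix of the distinct powers of `q`, so this
Gram matrix is nondegenerate. Both families of `n ^ 3` monomials span (`span_monomials`; the
generator `d` is redundant because `a` is invertible in the quotient). So both are bases and the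
pairing is perfect (`bijective_of_gram`); no basis theorem of Poincaré-Birkhoff-Witt type is needed
beforehand.

The remaining clauses are formal: `φ̄` is a bialgebra map into the dual, and a bialgebra map between
Hopf algebras commutes with the antipodes (`map_antipode`).
-/

noncomputable section

namespace QuantumSL2

/-! ### Bialgebra maps commute with antipodes -/

/-- Both `f ∘ S` and `S ∘ f` are convolution inverses of `f`. -/
theorem map_antipode {k H L : Type*} [Field k] [Ring H] [HopfAlgebra k H] [Ring L]
    [HopfAlgebra k L] (f : H →ₐc[k] L) (u : H) :
    f (HopfAlgebra.antipode k u) = HopfAlgebra.antipode k (f u) := by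
  let g : H →ₗ[k] L := (f : H →ₐ[k] L).toLinearMap
  have hleft : WithConv.toConv (g ∘ₗ HopfAlgebra.antipode k) * WithConv.toConv g = 1 := by
    ext c
    rw [(ℛ k c).convMul_apply]
    change ∑ i ∈ (ℛ k c).index, f (HopfAlgebra.antipode k ((ℛ k c).left i)) *
      f ((ℛ k c).right i) = _
    simp only [← map_mul, ← map_sum, HopfAlgebra.sum_antipode_mul_eq_algebraMap_counit (ℛ k c)]
    exact AlgHomClass.commutes f _
  have hright : WithConv.toConv g * WithConv.toConv (HopfAlgebra.antipode k ∘ₗ g) = 1 := by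
    ext c
    rw [LinearMap.convMul_apply, LinearMap.convOne_apply]
    change LinearMap.mul' k L (TensorProduct.map g (HopfAlgebra.antipode k ∘ₗ g) (comul c)) = _
    have hc : comul (R := k) (f c) = TensorProduct.map g g (comul c) :=
      (CoalgHomClass.map_comp_comul_apply f c).symm
    have h := HopfAlgebra.mul_antipode_lTensor_comul_apply (R := k) (f c)
    rw [hc, CoalgHomClass.counit_comp_apply f c] at h
    rw [← h, LinearMap.lTensor, TensorProduct.map_map, LinearMap.id_comp]
  exact LinearMap.congr_fun (congrArg WithConv.ofConv (left_inv_eq_right_inv hleft hright)) u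

/-! ### Nondegenerate pairings of spanning families -/

/-- Spanning families whose Gram matrix has trivial left kernel force both spaces to have the
dimension of the index set, so that the pairing identifies each space with the dual of the other. -/
theorem bijective_of_gram {k ι M N : Type*} [Field k] [Fintype ι] [AddCommGroup M] [Module k M]
    [AddCommGroup N] [Module k N] (B : M →ₗ[k] N →ₗ[k] k) (u : ι → M) (x : ι → N)
    (hu : ⊤ ≤ Submodule.span k (Set.range u)) (hx : ⊤ ≤ Submodule.span k (Set.range x))
    (h : ∀ α : ι → k, (∀ j, ∑ i, α i * B (u i) (x j) = 0) → α = 0) :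
    Function.Bijective B ∧ Function.Injective B.flip := by
  have hsum (α : ι → k) (hα : B (∑ i, α i • u i) = 0) : α = 0 := by
    refine h α fun j => ?_
    simpa using LinearMap.congr_fun hα (x j)
  have hli : LinearIndependent k u :=
    Fintype.linearIndependent_iff.2 fun α hα i => congrFun (hsum α (by rw [hα, map_zero])) i
  have hfM : Module.Finite k M :=
    ⟨(top_le_iff.1 hu) ▸ Submodule.fg_span (Set.finite_range u)⟩
  have hfN : Module.Finite k N :=
    ⟨(top_le_iff.1 hx) ▸ Submodule.fg_span (Set.finite_range x)⟩
  have hM : Module.finrank k M = Fintype.card ι :=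
    Module.finrank_eq_card_basis (Module.Basis.mk hli hu)
  have hN : Module.finrank k N ≤ Fintype.card ι := by
    rw [← finrank_top k N, ← top_le_iff.1 hx]
    exact finrank_range_le_card x
  have hinj : Function.Injective B := by
    refine (injective_iff_map_eq_zero B).2 fun m hm => ?_
    obtain ⟨α, rfl⟩ := (Submodule.mem_span_range_iff_exists_fun k).1
      (hu (Submodule.mem_top : m ∈ ⊤))
    simp [hsum α hm]
  have hle : Module.finrank k M ≤ Module.finrank k N := by
    rw [← Subspace.dual_finrank_eq (K := k) (V := N)]
    exact LinearMap.finrank_le_finrank_of_injective hinj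
  have hsurj : Function.Surjective B :=
    (LinearMap.injective_iff_surjective_of_finrank_eq_finrank
      (hle.antisymm (hN.trans hM.ge) |>.trans (Subspace.dual_finrank_eq (K := k) (V := N)).symm)).1
      hinj
  refine ⟨⟨hinj, hsurj⟩, (injective_iff_map_eq_zero B.flip).2 fun y hy => ?_⟩
  refine (Module.forall_dual_apply_eq_zero_iff k y).1 fun g => ?_
  obtain ⟨m, rfl⟩ := hsurj g
  exact LinearMap.congr_fun hy m

/-! ### Ordered monomials -/

theorem mul_pow_of_comm {k A : Type*} [Field k] [Ring A] [Algebra k A] {x y : A} {r : k}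
    (h : y * x = r • (x * y)) (m : ℕ) : y * x ^ m = r ^ m • (x ^ m * y) := by
  induction m with
  | zero => simp
  | succ m ih => rw [pow_succ, ← mul_assoc, ih, smul_mul_assoc, mul_assoc, h, mul_smul_comm,
      smul_smul, mul_assoc, pow_succ]

theorem pow_mul_of_comm {k A : Type*} [Field k] [Ring A] [Algebra k A] {x y : A} {r : k}
    (h : y * x = r • (x * y)) (m : ℕ) : y ^ m * x = r ^ m • (x * y ^ m) := by
  induction m with
  | zero => simp
  | succ m ih => rw [pow_succ, mul_assoc, h, mul_smul_comm, ← mul_assoc, ih, smul_mul_assoc,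
      smul_smul, mul_assoc, pow_succ, mul_comm]

/-- If `x`, `y`, `z` generate an algebra, `y` commutes with `x` and `z` up to scalars, and `x` and
`z` commute up to a scalar and a polynomial in `y`, then the ordered monomials span. -/
theorem span_monomials {k A : Type*} [Field k] [Ring A] [Algebra k A] {x y z w : A} {r s t : k}
    {n : ℕ} (hn : n ≠ 0) (hyx : y * x = r • (x * y)) (hzy : z * y = s • (y * z))
    (hzx : z * x = t • (x * z) + w) (hw : w ∈ Algebra.adjoin k {y})
    (hx : x ^ n = 0) (hy : y ^ n = 1) (hz : z ^ n = 0)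
    (h_adjoin : Algebra.adjoin k {x, y, z} = ⊤) :
    ⊤ ≤ Submodule.span k (Set.range fun p : Fin n × Fin n × Fin n =>
      x ^ (p.1 : ℕ) * y ^ (p.2.1 : ℕ) * z ^ (p.2.2 : ℕ)) := by
  let M : ℕ → ℕ → ℕ → A := fun i j l => x ^ i * y ^ j * z ^ l
  set W : Submodule k A := Submodule.span k (Set.range fun p : Fin n × Fin n × Fin n =>
      x ^ (p.1 : ℕ) * y ^ (p.2.1 : ℕ) * z ^ (p.2.2 : ℕ))
  have hM (i j l : ℕ) : M i j l ∈ W := by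
    by_cases hi : n ≤ i
    · simp [M, pow_eq_zero_of_le hi hx]
    by_cases hl : n ≤ l
    · simp [M, pow_eq_zero_of_le hl hz]
    have e : M i j l = M i (j % n) l := by simp only [M]; rw [← pow_eq_pow_mod j hy]
    rw [e]
    exact Submodule.subset_span ⟨(⟨i, by omega⟩, ⟨j % n, Nat.mod_lt _ (Nat.pos_of_ne_zero hn)⟩,
      ⟨l, by omega⟩), rfl⟩
  have left (a : A) (h : ∀ i j l, a * M i j l ∈ W) (v : A) (hv : v ∈ W) : a * v ∈ W := by
    induction hv using Submodule.span_induction with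
    | mem v hv => obtain ⟨⟨i, j, l⟩, rfl⟩ := hv; exact h i j l
    | zero => simp
    | add u v _ _ hu hv => rw [mul_add]; exact W.add_mem hu hv
    | smul c v _ hv => rw [mul_smul_comm]; exact W.smul_mem _ hv
  have right (a : A) (h : ∀ i j l, M i j l * a ∈ W) (v : A) (hv : v ∈ W) : v * a ∈ W := by
    induction hv using Submodule.span_induction with
    | mem v hv => obtain ⟨⟨i, j, l⟩, rfl⟩ := hv; exact h i j l
    | zero => simp
    | add u v _ _ hu hv => rw [add_mul]; exact W.add_mem hu hv
    | smul c v _ hv => rw [smul_mul_assoc]; exact W.smul_mem _ hv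
  have left_x := left x fun i j l => by
    have : x * M i j l = M (i + 1) j l := by simp only [M, ← mul_assoc, ← pow_succ']
    rw [this]; exact hM _ _ _
  have left_y := left y fun i j l => by
    have : y * M i j l = r ^ i • M i (j + 1) l := by
      simp only [M, ← mul_assoc]
      rw [mul_pow_of_comm hyx, smul_mul_assoc, smul_mul_assoc, mul_assoc (x ^ i) y, ← pow_succ']
    rw [this]; exact W.smul_mem _ (hM _ _ _)
  have right_z := right z fun i j l => by
    have : M i j l * z = M i j (l + 1) := by simp only [M, mul_assoc, ← pow_succ]
    rw [this]; exact hM _ _ _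
  have right_y := right y fun i j l => by
    have : M i j l * y = s ^ l • M i (j + 1) l := by
      simp only [M]
      rw [mul_assoc, pow_mul_of_comm hzy, mul_smul_comm, ← mul_assoc, mul_assoc (x ^ i) _ y,
        ← pow_succ]
    rw [this]; exact W.smul_mem _ (hM _ _ _)
  have right_pow (a : A) (h : ∀ v ∈ W, v * a ∈ W) (m : ℕ) (v : A) (hv : v ∈ W) :
      v * a ^ m ∈ W := by
    induction m with
    | zero => simpa using hv
    | succ m ih => rw [pow_succ, ← mul_assoc]; exact h _ ih
  have adj (S : Set A) (hS : ∀ a ∈ S, ∀ v ∈ W, a * v ∈ W) (a : A) (ha : a ∈ Algebra.adjoin k S) :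
      ∀ v ∈ W, a * v ∈ W := by
    induction ha using Algebra.adjoin_induction with
    | mem a ha => exact hS a ha
    | algebraMap c => intro v hv; rw [← Algebra.smul_def]; exact W.smul_mem _ hv
    | mul a b _ _ ha hb => intro v hv; rw [mul_assoc]; exact ha _ (hb _ hv)
    | add a b _ _ ha hb => intro v hv; rw [add_mul]; exact W.add_mem (ha _ hv) (hb _ hv)
  have left_w := adj {y} (by rintro _ rfl; exact left_y) w hw
  have hzxi (i : ℕ) : z * x ^ i ∈ W := by
    induction i with
    | zero => simpa [M] using hM 0 0 1
    | succ i ih =>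
      rw [pow_succ', ← mul_assoc, hzx, add_mul, smul_mul_assoc, mul_assoc]
      exact W.add_mem (W.smul_mem _ (left_x _ ih)) (left_w _ (by simpa [M] using hM i 0 0))
  have left_z := left z fun i j l => by
    have : z * M i j l = z * x ^ i * y ^ j * z ^ l := by simp only [M, mul_assoc]
    rw [this]
    exact right_pow z right_z l _ (right_pow y right_y j _ (hzxi i))
  intro a _
  have := adj {x, y, z} (by rintro _ (rfl | rfl | rfl) <;> assumption) a
    (h_adjoin ▸ Algebra.mem_top) 1 (by simpa [M] using hM 0 0 0)
  rwa [mul_one] at this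

end QuantumSL2

/-! ### Regular actions on the dual -/

namespace HopfDual

variable {k H : Type*} [Field k] [Ring H] [HopfAlgebra k H]

/-- The action of `H` on `H*` transposed to right multiplication, `(x ⇀ f)(y) = f(yx)`. -/
def leftAct (x : H) : HopfDual k H →ₗ[k] HopfDual k H :=
  (toDual k H).symm.toLinearMap ∘ₗ (LinearMap.mulRight k x).dualMap ∘ₗ (toDual k H).toLinearMap

/-- The action of `H` on `H*` transposed to left multiplication, `(f ↼ x)(y) = f(xy)`. -/
def rightAct (x : H) : HopfDual k H →ₗ[k] HopfDual k H :=
  (toDual k H).symm.toLinearMap ∘ₗ (LinearMap.mulLeft k x).dualMap ∘ₗ (toDual k H).toLinearMap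

theorem leftAct_apply (x : H) (f : HopfDual k H) (y : H) : leftAct x f y = f (y * x) := rfl

theorem rightAct_apply (x : H) (f : HopfDual k H) (y : H) : rightAct x f y = f (x * y) := rfl

theorem leftAct_mul {x x₁ x₂ y₁ y₂ : H} (h : comul (R := k) x = x₁ ⊗ₜ[k] x₂ + y₁ ⊗ₜ[k] y₂)
    (f g : HopfDual k H) :
    leftAct x (f * g) = leftAct x₁ f * leftAct x₂ g + leftAct y₁ f * leftAct y₂ g := by
  refine ext fun y => ?_
  rw [leftAct_apply, add_apply, mul_apply, mul_apply, mul_apply, Bialgebra.comul_mul, h]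
  generalize (comul y : H ⊗[k] H) = s
  induction s with
  | zero => simp
  | add s₁ s₂ h₁ h₂ => rw [add_mul, map_add, map_add, h₁, h₂]; simp only [map_add]; abel
  | tmul s₁ s₂ => simp [mul_add, leftAct_apply]

theorem rightAct_mul {x x₁ x₂ y₁ y₂ : H} (h : comul (R := k) x = x₁ ⊗ₜ[k] x₂ + y₁ ⊗ₜ[k] y₂)
    (f g : HopfDual k H) :
    rightAct x (f * g) = rightAct x₁ f * rightAct x₂ g + rightAct y₁ f * rightAct y₂ g := by
  refine ext fun y => ?_
  rw [rightAct_apply, add_apply, mul_apply, mul_apply, mul_apply, Bialgebra.comul_mul, h]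
  generalize (comul y : H ⊗[k] H) = s
  induction s with
  | zero => simp
  | add s₁ s₂ h₁ h₂ => rw [mul_add, map_add, map_add, h₁, h₂]; simp only [map_add]; abel
  | tmul s₁ s₂ => simp [add_mul, rightAct_apply]

theorem leftAct_one (f : HopfDual k H) : leftAct 1 f = f :=
  ext fun y => by rw [leftAct_apply, mul_one]

theorem rightAct_one (f : HopfDual k H) : rightAct 1 f = f :=
  ext fun y => by rw [rightAct_apply, one_mul]

theorem leftAct_unit (x : H) : leftAct x (1 : HopfDual k H) = counit (R := k) x • 1 :=
  ext fun y => by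
    rw [leftAct_apply, smul_apply, one_apply, one_apply, Bialgebra.counit_mul, mul_comm]

theorem rightAct_unit (x : H) : rightAct x (1 : HopfDual k H) = counit (R := k) x • 1 :=
  ext fun y => by rw [rightAct_apply, smul_apply, one_apply, one_apply, Bialgebra.counit_mul]

theorem mul_apply_groupLike {x : H} (h : comul (R := k) x = x ⊗ₜ[k] x) (f g : HopfDual k H) :
    (f * g) x = f x * g x := by
  rw [mul_apply, h, TensorProduct.map_tmul, LinearMap.mul'_apply, toDual_apply, toDual_apply]

theorem pow_apply_groupLike {x : H} (h : comul (R := k) x = x ⊗ₜ[k] x)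
    (h' : counit (R := k) x = 1) (f : HopfDual k H) (m : ℕ) : (f ^ m) x = f x ^ m := by
  induction m with
  | zero => rw [pow_zero, pow_zero, one_apply, h']
  | succ m ih => rw [pow_succ, pow_succ, mul_apply_groupLike h, ih]

/-- A skew derivation killing `f` kills its powers. -/
theorem leftAct_pow_eq_zero {x g : H} (h : comul (R := k) x = 1 ⊗ₜ[k] x + x ⊗ₜ[k] g)
    (hx : counit (R := k) x = 0) {f : HopfDual k H} (hf : leftAct x f = 0) (m : ℕ) :
    leftAct x (f ^ m) = 0 := by
  induction m with
  | zero => rw [pow_zero, leftAct_unit, hx, zero_smul]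
  | succ m ih => rw [pow_succ, leftAct_mul h, hf, ih, mul_zero, zero_mul, add_zero]

/-- A skew derivation killing `f` kills its powers. -/
theorem rightAct_pow_eq_zero {x g : H} (h : comul (R := k) x = g ⊗ₜ[k] x + x ⊗ₜ[k] 1)
    (hx : counit (R := k) x = 0) {f : HopfDual k H} (hf : rightAct x f = 0) (m : ℕ) :
    rightAct x (f ^ m) = 0 := by
  induction m with
  | zero => rw [pow_zero, rightAct_unit, hx, zero_smul]
  | succ m ih => rw [pow_succ, rightAct_mul h, hf, ih, mul_zero, zero_mul, add_zero]

end HopfDual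

namespace QuantumSL2

variable {k : Type*} [Field k] (q : kˣ) (n : ℕ)

/-! ### Quantum integers and factorials -/

/-- The symmetric quantum integer `[m] = (q ^ m - q ^ (-m)) / (q - q⁻¹)`. -/
def qInt (m : ℕ) : k := ((q : k) ^ m - ((q : k)⁻¹) ^ m) / ((q : k) - (q : k)⁻¹)

/-- The quantum factorial `[m]! = [1] ⋯ [m]`. -/
def qFactorial (m : ℕ) : k := ∏ i ∈ Finset.range m, qInt q (i + 1)

theorem qInt_zero : qInt q 0 = 0 := by simp [qInt]

theorem qInt_succ [OddPrimitiveRoot q n] (m : ℕ) :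
    qInt q (m + 1) = (q : k) ^ m + (q : k)⁻¹ * qInt q m := by
  have h := OddPrimitiveRoot.sub_inv_ne_zero (q := q) n
  rw [qInt, qInt, div_eq_iff h, add_mul, mul_assoc, div_mul_cancel₀ _ h, pow_succ, pow_succ]
  ring

theorem qInt_succ' [OddPrimitiveRoot q n] (m : ℕ) :
    qInt q (m + 1) = (q : k) * qInt q m + ((q : k)⁻¹) ^ m := by
  have h := OddPrimitiveRoot.sub_inv_ne_zero (q := q) n
  rw [qInt, qInt, div_eq_iff h, add_mul, mul_assoc, div_mul_cancel₀ _ h, pow_succ, pow_succ]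
  ring

theorem qInt_ne_zero [h : OddPrimitiveRoot q n] {m : ℕ} (h0 : m ≠ 0) (hm : m < n) :
    qInt q m ≠ 0 := by
  refine div_ne_zero (fun e => ?_) (OddPrimitiveRoot.sub_inv_ne_zero n)
  refine h.sq.pow_ne_one_of_pos_of_lt h0 hm ?_
  rw [← pow_mul, mul_comm, pow_mul, pow_two]
  nth_rewrite 2 [sub_eq_zero.1 e]
  rw [← mul_pow, mul_inv_cancel₀ q.ne_zero, one_pow]

theorem qFactorial_succ (m : ℕ) : qFactorial q (m + 1) = qInt q (m + 1) * qFactorial q m := by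
  rw [qFactorial, Finset.prod_range_succ, mul_comm]; rfl

theorem qFactorial_ne_zero [OddPrimitiveRoot q n] {m : ℕ} (hm : m < n) : qFactorial q m ≠ 0 :=
  Finset.prod_ne_zero_iff.2 fun i hi =>
    qInt_ne_zero q n i.succ_ne_zero (by rw [Finset.mem_range] at hi; omega)

/-! ### Generators of the two finite-dimensional Hopf algebras -/

namespace SmallUq

/-- The class of a generator in `u_q(sl₂)`. -/
def gen (x : UqGen) : SmallUq q n := Ideal.Quotient.mk _ (Uq.gen q x)

variable [OddPrimitiveRoot q n]

theorem comul_E : comul (R := k) (gen q n .E) =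
    1 ⊗ₜ[k] gen q n .E + gen q n .E ⊗ₜ[k] gen q n .K := by
  rw [gen, Bialgebra.Quotient.comul_mk, Uq.comul_gen]; rfl

theorem comul_F : comul (R := k) (gen q n .F) =
    gen q n .Kinv ⊗ₜ[k] gen q n .F + gen q n .F ⊗ₜ[k] 1 := by
  rw [gen, Bialgebra.Quotient.comul_mk, Uq.comul_gen]; rfl

theorem comul_K : comul (R := k) (gen q n .K) = gen q n .K ⊗ₜ[k] gen q n .K := by
  rw [gen, Bialgebra.Quotient.comul_mk, Uq.comul_gen]; rfl

theorem counit_gen (x : UqGen) : counit (R := k) (gen q n x) = Uq.counitGen x := by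
  rw [gen, Bialgebra.Quotient.counit_mk, Uq.counit_gen]

theorem rhoSmall_gen (x : UqGen) : rhoSmall q n (gen q n x) = rhoGen q x :=
  (rhoSmall_mk q n _).trans (rho_gen q n x)

end SmallUq

/-! ### The pairing on ordered monomials -/

section Monomials

variable [OddPrimitiveRoot q n]

/-- The functional `C ^ l A ^ i B ^ j` on `u_q(sl₂)`. -/
def mono (l i j : ℕ) : HopfDual k (SmallUq q n) :=
  coeffGen (rhoSmall q n) .c ^ l * coeffGen (rhoSmall q n) .a ^ i *
    coeffGen (rhoSmall q n) .b ^ j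

open HopfDual SmallUq

theorem leftAct_E_a : leftAct (gen q n .E) (coeffGen (rhoSmall q n) .a) = 0 :=
  HopfDual.ext fun x => by
    simp [leftAct_apply, coeffGen, coeff_apply, map_mul, rhoSmall_gen, rhoGen, Matrix.mul_apply]

theorem leftAct_E_b :
    leftAct (gen q n .E) (coeffGen (rhoSmall q n) .b) = coeffGen (rhoSmall q n) .a :=
  HopfDual.ext fun x => by
    simp [leftAct_apply, coeffGen, coeff_apply, map_mul, rhoSmall_gen, rhoGen, Matrix.mul_apply]

theorem leftAct_E_c : leftAct (gen q n .E) (coeffGen (rhoSmall q n) .c) = 0 :=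
  HopfDual.ext fun x => by
    simp [leftAct_apply, coeffGen, coeff_apply, map_mul, rhoSmall_gen, rhoGen, Matrix.mul_apply]

theorem leftAct_K_b : leftAct (gen q n .K) (coeffGen (rhoSmall q n) .b) =
    (q : k)⁻¹ • coeffGen (rhoSmall q n) .b :=
  HopfDual.ext fun x => by
    simp [leftAct_apply, coeffGen, coeff_apply, map_mul, rhoSmall_gen, rhoGen, Matrix.mul_apply,
      mul_comm]

theorem rightAct_F_a : rightAct (gen q n .F) (coeffGen (rhoSmall q n) .a) = 0 :=
  HopfDual.ext fun x => by
    simp [rightAct_apply, coeffGen, coeff_apply, map_mul, rhoSmall_gen, rhoGen, Matrix.mul_apply]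

theorem rightAct_F_b : rightAct (gen q n .F) (coeffGen (rhoSmall q n) .b) = 0 :=
  HopfDual.ext fun x => by
    simp [rightAct_apply, coeffGen, coeff_apply, map_mul, rhoSmall_gen, rhoGen, Matrix.mul_apply]

theorem rightAct_F_c :
    rightAct (gen q n .F) (coeffGen (rhoSmall q n) .c) = coeffGen (rhoSmall q n) .a :=
  HopfDual.ext fun x => by
    simp [rightAct_apply, coeffGen, coeff_apply, map_mul, rhoSmall_gen, rhoGen, Matrix.mul_apply]

theorem rightAct_Kinv_c : rightAct (gen q n .Kinv) (coeffGen (rhoSmall q n) .c) =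
    (q : k) • coeffGen (rhoSmall q n) .c :=
  HopfDual.ext fun x => by
    simp [rightAct_apply, coeffGen, coeff_apply, map_mul, rhoSmall_gen, rhoGen, Matrix.mul_apply]

theorem leftAct_E_b_pow (j : ℕ) :
    leftAct (gen q n .E) (coeffGen (rhoSmall q n) .b ^ (j + 1)) =
      qInt q (j + 1) • (coeffGen (rhoSmall q n) .a * coeffGen (rhoSmall q n) .b ^ j) := by
  have hba := (coeffGen_rel (fixes_rhoSmall q n)).1
  induction j with
  | zero =>
    rw [zero_add, pow_one, pow_zero, mul_one, leftAct_E_b, qInt_succ q n, qInt_zero, mul_zero,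
      pow_zero, add_zero, one_smul]
  | succ j ih =>
    rw [pow_succ, leftAct_mul (comul_E q n), leftAct_one, leftAct_E_b, leftAct_K_b, ih,
      pow_mul_of_comm hba, smul_mul_assoc, mul_smul_comm, smul_smul, mul_assoc, ← pow_succ,
      ← add_smul, qInt_succ q n (j + 1), mul_comm (qInt q (j + 1))]

theorem rightAct_F_c_pow (l : ℕ) :
    rightAct (gen q n .F) (coeffGen (rhoSmall q n) .c ^ (l + 1)) =
      qInt q (l + 1) • (coeffGen (rhoSmall q n) .c ^ l * coeffGen (rhoSmall q n) .a) := by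
  have hac : coeffGen (rhoSmall q n) .a * coeffGen (rhoSmall q n) .c =
      (q : k)⁻¹ • (coeffGen (rhoSmall q n) .c * coeffGen (rhoSmall q n) .a) := by
    rw [(coeffGen_rel (fixes_rhoSmall q n)).2.1, smul_smul, inv_mul_cancel₀ q.ne_zero, one_smul]
  induction l with
  | zero =>
    rw [zero_add, pow_one, pow_zero, one_mul, rightAct_F_c, qInt_succ q n, qInt_zero, mul_zero,
      pow_zero, add_zero, one_smul]
  | succ l ih =>
    rw [pow_succ', rightAct_mul (comul_F q n), rightAct_one, rightAct_F_c, rightAct_Kinv_c, ih,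
      mul_pow_of_comm hac, smul_mul_assoc, mul_smul_comm, smul_smul, ← mul_assoc, ← pow_succ',
      ← add_smul, qInt_succ' q n (l + 1)]

theorem leftAct_E_c_a (l i : ℕ) : leftAct (gen q n .E)
    (coeffGen (rhoSmall q n) .c ^ l * coeffGen (rhoSmall q n) .a ^ i) = 0 := by
  have hE : counit (R := k) (gen q n .E) = 0 := counit_gen q n .E
  rw [leftAct_mul (comul_E q n), leftAct_pow_eq_zero (comul_E q n) hE (leftAct_E_a q n),
    leftAct_pow_eq_zero (comul_E q n) hE (leftAct_E_c q n), mul_zero, zero_mul, add_zero]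

theorem rightAct_F_a_b (i j : ℕ) : rightAct (gen q n .F)
    (coeffGen (rhoSmall q n) .a ^ i * coeffGen (rhoSmall q n) .b ^ j) = 0 := by
  have hF : counit (R := k) (gen q n .F) = 0 := counit_gen q n .F
  rw [rightAct_mul (comul_F q n), rightAct_pow_eq_zero (comul_F q n) hF (rightAct_F_a q n),
    rightAct_pow_eq_zero (comul_F q n) hF (rightAct_F_b q n), mul_zero, zero_mul, add_zero]

theorem leftAct_E_mono_zero (l i : ℕ) : leftAct (gen q n .E) (mono q n l i 0) = 0 := by
  rw [mono, pow_zero, mul_one, leftAct_E_c_a]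

theorem leftAct_E_mono_succ (l i j : ℕ) :
    leftAct (gen q n .E) (mono q n l i (j + 1)) = qInt q (j + 1) • mono q n l (i + 1) j := by
  rw [mono, leftAct_mul (comul_E q n), leftAct_E_c_a, zero_mul, add_zero, leftAct_one,
    leftAct_E_b_pow, mul_smul_comm, mono, pow_succ _ i]
  simp only [mul_assoc]

theorem rightAct_F_mono_zero (i j : ℕ) : rightAct (gen q n .F) (mono q n 0 i j) = 0 := by
  rw [mono, pow_zero, one_mul, rightAct_F_a_b]

theorem rightAct_F_mono_succ (l i j : ℕ) :
    rightAct (gen q n .F) (mono q n (l + 1) i j) = qInt q (l + 1) • mono q n l (i + 1) j := by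
  rw [mono, mul_assoc, rightAct_mul (comul_F q n), rightAct_F_a_b, mul_zero, zero_add,
    rightAct_one, rightAct_F_c_pow, smul_mul_assoc, mono, pow_succ' _ i]
  simp only [mul_assoc]

theorem mono_apply_K (l i j s : ℕ) :
    mono q n l i j (gen q n .K ^ s) = if l = 0 ∧ j = 0 then (q : k) ^ (s * i) else 0 := by
  have hc : comul (R := k) (gen q n .K ^ s) = (gen q n .K ^ s) ⊗ₜ[k] (gen q n .K ^ s) := by
    rw [Bialgebra.comul_pow, comul_K, Algebra.TensorProduct.tmul_pow]
  have he : counit (R := k) (gen q n .K ^ s) = 1 := by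
    rw [Bialgebra.counit_pow, counit_gen]; exact one_pow s
  have hd : rhoGen q .K = Matrix.diagonal ![(q : k), (q : k)⁻¹] := by
    ext i j; fin_cases i <;> fin_cases j <;> simp [rhoGen]
  have hr : rhoSmall q n (gen q n .K ^ s) = Matrix.diagonal (![(q : k), (q : k)⁻¹] ^ s) := by
    rw [map_pow, rhoSmall_gen, hd, Matrix.diagonal_pow]
  rw [mono, mul_apply_groupLike hc, mul_apply_groupLike hc, pow_apply_groupLike hc he,
    pow_apply_groupLike hc he, pow_apply_groupLike hc he]
  simp only [coeffGen, coeff_apply, hr]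
  rcases Nat.eq_zero_or_pos l with rfl | hl
  · rcases Nat.eq_zero_or_pos j with rfl | hj
    · simp [pow_mul]
    · simp [hj.ne']
  · simp [hl.ne']

theorem mono_apply_F_K (l i j r s : ℕ) :
    mono q n l i j (gen q n .F ^ r * gen q n .K ^ s) =
      if r = l ∧ j = 0 then qFactorial q l * (q : k) ^ (s * (i + l)) else 0 := by
  induction r generalizing l i with
  | zero =>
    rw [pow_zero, one_mul, mono_apply_K]
    rcases l with _ | l
    · simp [qFactorial]
    · simp
  | succ r ih =>
    rw [pow_succ', mul_assoc, ← rightAct_apply]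
    rcases l with _ | l
    · rw [rightAct_F_mono_zero]; simp
    · rw [rightAct_F_mono_succ, HopfDual.smul_apply, ih, qFactorial_succ,
        show i + 1 + l = i + (l + 1) by ring]
      simp [mul_assoc]

/-- The Gram matrix on monomials vanishes outside of `r = l`, `t = j`, where up to a factor it is
the Vandermonde matrix in the powers of `q`. -/
theorem mono_apply (l i j r s t : ℕ) :
    mono q n l i j (gen q n .F ^ r * gen q n .K ^ s * gen q n .E ^ t) =
      if r = l ∧ t = j then
        qFactorial q l * qFactorial q j * (q : k) ^ (s * (i + j + l)) else 0 := by
  induction t generalizing i j with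
  | zero =>
    rw [pow_zero, mul_one, mono_apply_F_K]
    rcases j with _ | j
    · simp [qFactorial]
    · simp
  | succ t ih =>
    rw [pow_succ, ← mul_assoc, ← leftAct_apply]
    rcases j with _ | j
    · rw [leftAct_E_mono_zero]; simp
    · rw [leftAct_E_mono_succ, HopfDual.smul_apply, ih, qFactorial_succ,
        show i + 1 + j = i + (j + 1) by ring]
      simp only [add_left_inj, mul_ite, mul_zero]
      congr 1
      ring

end Monomials

end QuantumSL2

namespace QuantumSL2

variable {k : Type*} [Field k] (q : kˣ) (n : ℕ)

/-! ### Monomials span -/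

theorem SmallUq.span_monomials [h : OddPrimitiveRoot q n] :
    ⊤ ≤ Submodule.span k (Set.range fun p : Fin n × Fin n × Fin n =>
      SmallUq.gen q n .F ^ (p.1 : ℕ) * SmallUq.gen q n .K ^ (p.2.1 : ℕ) *
        SmallUq.gen q n .E ^ (p.2.2 : ℕ)) := by
  obtain ⟨hK, hE, hF⟩ := SmallUq.pow_eq q n
  have hn := h.ne_zero
  let π := Ideal.Quotient.mkₐ k (uqIdeal q n)
  have hinv : π (Uq.Kinv q) = π (Uq.K q) ^ (n - 1) := by
    have h1 : π (Uq.Kinv q) * π (Uq.K q) ^ n = π (Uq.Kinv q) := by rw [hK, mul_one]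
    rw [← h1, ← mul_pow_sub_one hn (π (Uq.K q)), ← mul_assoc, ← map_mul, Uq.Kinv_mul_K, map_one,
      one_mul]
  have hinv_mem : π (Uq.Kinv q) ∈ Algebra.adjoin k {π (Uq.K q)} :=
    hinv ▸ Subalgebra.pow_mem _ (Algebra.self_mem_adjoin_singleton k _) _
  refine QuantumSL2.span_monomials (x := π (Uq.F q)) (y := π (Uq.K q)) (z := π (Uq.E q))
    (r := ((q : k) ^ 2)⁻¹) (s := ((q : k) ^ 2)⁻¹) (t := 1)
    (w := ((q : k) - (q : k)⁻¹)⁻¹ • (π (Uq.K q) - π (Uq.Kinv q))) hn ?_ ?_ ?_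
    (Subalgebra.smul_mem _ (Subalgebra.sub_mem _ (Algebra.self_mem_adjoin_singleton k _)
      hinv_mem) _) hF hK hE ?_
  · rw [← map_mul, Uq.K_mul_F, map_smul, map_mul]
  · rw [← map_mul, ← map_mul, Uq.K_mul_E, map_smul, smul_smul,
      inv_mul_cancel₀ (pow_ne_zero _ q.ne_zero), one_smul]
  · rw [← map_mul, Uq.E_mul_F, map_add, map_mul, map_smul, map_sub, one_smul]
  · refine eq_top_iff.2 ?_
    have h1 : (⊤ : Subalgebra k (SmallUq q n)) =
        (Algebra.adjoin k (Set.range (Uq.gen q))).map π := by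
      rw [Uq.adjoin_gen, Algebra.map_top, eq_comm, AlgHom.range_eq_top]
      exact Ideal.Quotient.mk_surjective
    rw [h1, AlgHom.map_adjoin, Algebra.adjoin_le_iff]
    rintro _ ⟨_, ⟨x, rfl⟩, rfl⟩
    cases x with
    | E => exact Algebra.subset_adjoin (by simp)
    | F => exact Algebra.subset_adjoin (by simp)
    | K => exact Algebra.subset_adjoin (by simp)
    | Kinv => exact Algebra.adjoin_mono (by simp) hinv_mem

/-- The monomials in `a`, `b`, `c` suffice since `d = a ^ (n - 1) (q⁻¹ bc + 1)`. -/
theorem OqBar.span_monomials [h : OddPrimitiveRoot q n] :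
    ⊤ ≤ Submodule.span k (Set.range fun p : Fin n × Fin n × Fin n =>
      Ideal.Quotient.mkₐ k (oqIdeal q n) (Oq.c q) ^ (p.1 : ℕ) *
        Ideal.Quotient.mkₐ k (oqIdeal q n) (Oq.a q) ^ (p.2.1 : ℕ) *
        Ideal.Quotient.mkₐ k (oqIdeal q n) (Oq.b q) ^ (p.2.2 : ℕ)) := by
  have hn := h.ne_zero
  have ha := mk_of_mem (k := k) (s := {Oq.a q ^ n - 1, Oq.b q ^ n, Oq.c q ^ n, Oq.d q ^ n - 1})
    (x := Oq.a q ^ n - 1) (by simp)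
  have hb := mk_of_mem (k := k) (s := {Oq.a q ^ n - 1, Oq.b q ^ n, Oq.c q ^ n, Oq.d q ^ n - 1})
    (x := Oq.b q ^ n) (by simp)
  have hc := mk_of_mem (k := k) (s := {Oq.a q ^ n - 1, Oq.b q ^ n, Oq.c q ^ n, Oq.d q ^ n - 1})
    (x := Oq.c q ^ n) (by simp)
  rw [map_sub, map_one, sub_eq_zero, map_pow] at ha
  rw [map_pow] at hb hc
  let π := Ideal.Quotient.mkₐ k (oqIdeal q n)
  have hd : π (Oq.d q) =
      π (Oq.a q) ^ (n - 1) * ((q : k)⁻¹ • (π (Oq.b q) * π (Oq.c q)) + 1) := by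
    have h1 : π (Oq.a q) ^ n * π (Oq.d q) = π (Oq.d q) := by
      rw [show π (Oq.a q) ^ n = 1 from ha, one_mul]
    rw [← h1, ← pow_sub_one_mul hn (π (Oq.a q)), mul_assoc, ← map_mul π, Oq.a_mul_d, map_add,
      map_one, map_smul, map_mul]
  refine QuantumSL2.span_monomials (x := π (Oq.c q)) (y := π (Oq.a q)) (z := π (Oq.b q))
    (r := (q : k)⁻¹) (s := q) (t := 1) (w := 0) hn ?_ ?_ ?_ (Subalgebra.zero_mem _) hc ha hb ?_
  · rw [← map_mul, ← map_mul, Oq.c_mul_a, map_smul, smul_smul, inv_mul_cancel₀ q.ne_zero,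
      one_smul]
  · rw [← map_mul, Oq.b_mul_a, map_smul, map_mul]
  · rw [← map_mul, ← map_mul, Oq.c_mul_b, one_smul, add_zero]
  · refine eq_top_iff.2 ?_
    have h1 : (⊤ : Subalgebra k (OqBar q n)) =
        (Algebra.adjoin k (Set.range (Oq.gen q))).map π := by
      rw [Oq.adjoin_gen, Algebra.map_top, eq_comm, AlgHom.range_eq_top]
      exact Ideal.Quotient.mk_surjective
    rw [h1, AlgHom.map_adjoin, Algebra.adjoin_le_iff]
    have mem (x : OqBar q n) (hx : x ∈ ({π (Oq.c q), π (Oq.a q), π (Oq.b q)} : Set _)) :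
        x ∈ Algebra.adjoin k ({π (Oq.c q), π (Oq.a q), π (Oq.b q)} : Set (OqBar q n)) :=
      Algebra.subset_adjoin hx
    rintro _ ⟨_, ⟨x, rfl⟩, rfl⟩
    cases x with
    | a => exact mem _ (by simp)
    | b => exact mem _ (by simp)
    | c => exact mem _ (by simp)
    | d =>
      change π (Oq.d q) ∈ _
      rw [hd]
      exact Subalgebra.mul_mem _ (Subalgebra.pow_mem _ (mem _ (by simp)) _)
        (Subalgebra.add_mem _ (Subalgebra.smul_mem _ (Subalgebra.mul_mem _ (mem _ (by simp))
          (mem _ (by simp))) _) (Subalgebra.one_mem _))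

/-! ### The pairing is a perfect Hopf duality -/

section Pairing

variable [OddPrimitiveRoot q n]

theorem phiBar_gen (x : OqGen) : phiBar q n (Ideal.Quotient.mkₐ k (oqIdeal q n) (Oq.gen q x)) =
    coeffGen (rhoSmall q n) x := phiSmallHom_gen q n x

theorem phiBar_mk_apply_mk (u : Oq q) (x : Uq q) :
    phiBar q n (Ideal.Quotient.mk _ u) (Ideal.Quotient.mk _ x) = phi q n u x := by
  have hu : u ∈ Algebra.adjoin k (Set.range (Oq.gen q)) := by
    rw [Oq.adjoin_gen]; exact Algebra.mem_top
  change phiSmallHom q n u (Ideal.Quotient.mk _ x) = phi q n u x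
  induction hu using Algebra.adjoin_induction generalizing x with
  | mem u hu =>
    obtain ⟨u, rfl⟩ := hu
    rw [phiSmallHom_gen, phi_gen]
    cases u <;> rfl
  | algebraMap c =>
    rw [AlgHom.commutes, AlgHom.commutes, Algebra.algebraMap_eq_smul_one,
      Algebra.algebraMap_eq_smul_one, HopfDual.smul_apply, HopfDual.smul_apply,
      HopfDual.one_apply, HopfDual.one_apply, Bialgebra.Quotient.counit_mk]
  | mul u v _ _ hu hv => rw [map_mul, map_mul]; exact mul_apply_mk q n _ _ _ _ hu hv x
  | add u v _ _ hu hv =>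
    rw [map_add, map_add, HopfDual.add_apply, HopfDual.add_apply, hu, hv]

theorem pairing_bijective :
    Function.Bijective (pairing q n) ∧ Function.Injective (pairing q n).flip := by
  refine bijective_of_gram (pairing q n) _ _ (OqBar.span_monomials q n)
    (SmallUq.span_monomials q n) fun α hα => ?_
  have hq : Function.Injective fun i : Fin n => (q : k) ^ (i : ℕ) := fun i j e =>
    Fin.ext ((OddPrimitiveRoot.isPrimitiveRoot (q := q) (n := n)).pow_inj i.2 j.2 e)
  have hgram (l i j r s t : ℕ) : pairing q n
      (Ideal.Quotient.mkₐ k (oqIdeal q n) (Oq.c q) ^ l *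
        Ideal.Quotient.mkₐ k (oqIdeal q n) (Oq.a q) ^ i *
        Ideal.Quotient.mkₐ k (oqIdeal q n) (Oq.b q) ^ j)
      (SmallUq.gen q n .F ^ r * SmallUq.gen q n .K ^ s * SmallUq.gen q n .E ^ t) =
      if r = l ∧ t = j then
        qFactorial q l * qFactorial q j * (q : k) ^ (s * (i + j + l)) else 0 := by
    rw [← mono_apply q n]
    change phiBar q n _ _ = _
    rw [map_mul (phiBar q n), map_mul (phiBar q n), map_pow (phiBar q n), map_pow (phiBar q n),
      map_pow (phiBar q n), phiBar_gen, phiBar_gen, phiBar_gen, mono]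
  have key (l j : Fin n) : (fun i : Fin n => α (l, i, j)) = 0 := by
    refine Matrix.eq_zero_of_forall_pow_sum_mul_pow_eq_zero hq fun s => ?_
    have hs := hα (l, s, j)
    simp only [hgram, Fintype.sum_prod_type] at hs
    rw [Finset.sum_eq_single l (fun l' _ hl' => by
      simp [Fin.val_inj, hl'.symm]) (by simp)] at hs
    have hc : qFactorial q (l : ℕ) * qFactorial q (j : ℕ) * (q : k) ^ ((s : ℕ) * (j + l)) ≠ 0 :=
      mul_ne_zero (mul_ne_zero (qFactorial_ne_zero q n l.2) (qFactorial_ne_zero q n j.2))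
        (pow_ne_zero _ q.ne_zero)
    refine (mul_eq_zero.1 (Eq.trans ?_ hs)).resolve_left hc
    rw [Finset.mul_sum]
    refine Finset.sum_congr rfl fun i _ => ?_
    rw [Finset.sum_eq_single j (fun j' _ hj' => by simp [Fin.val_inj, hj'.symm]) (by simp),
      if_pos ⟨rfl, rfl⟩]
    ring
  funext p
  exact congrFun (key p.1 p.2.2) p.2.1

theorem isHopfDuality_pairing : IsHopfDuality (pairing q n) where
  mul_left u v x := by
    change phiBar q n (u * v) x = _
    rw [map_mul]; rfl
  mul_right u x y := by
    have h := HopfDual.tensorEquiv_comul (phiBar q n u) (x ⊗ₜ[k] y)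
    rw [LinearMap.mul'_apply, ← CoalgHomClass.map_comp_comul_apply] at h
    change phiBar q n u (x * y) = _
    rw [← h]
    generalize (comul u : OqBar q n ⊗[k] OqBar q n) = s
    induction s with
    | zero => simp
    | add s₁ s₂ h₁ h₂ => rw [map_add, map_add, map_add, map_add, LinearMap.add_apply, h₁, h₂]
    | tmul s₁ s₂ => rfl
  one_left x := by
    change phiBar q n 1 x = _
    rw [map_one, HopfDual.one_apply]
  one_right u := CoalgHomClass.counit_comp_apply (phiBar q n) u
  antipode u x := by
    change phiBar q n (HopfAlgebra.antipode k u) x = _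
    rw [map_antipode]; rfl

end Pairing

end QuantumSL2

end

theorem propositionA {k : Type*} [Field k] [IsAlgClosed k] [CharZero k] (q : kˣ) (n : ℕ)
    [QuantumSL2.OddPrimitiveRoot q n] :
    (∀ (u : QuantumSL2.Oq q) (x : QuantumSL2.Uq q),
      QuantumSL2.phiBar q n (Ideal.Quotient.mk _ u) (Ideal.Quotient.mk _ x) =
        QuantumSL2.phi q n u x) ∧
    (∀ u : QuantumSL2.OqBar q n, QuantumSL2.phiBar q n (HopfAlgebra.antipode k u) =
      HopfAlgebra.antipode k (QuantumSL2.phiBar q n u)) ∧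
    Function.Surjective (QuantumSL2.phiBar q n) ∧
    Function.Bijective (QuantumSL2.phiBar q n) ∧
    IsPerfectHopfDuality (QuantumSL2.pairing q n) := by
  obtain ⟨hbij, hflip⟩ := QuantumSL2.pairing_bijective q n
  have hphi : Function.Bijective (QuantumSL2.phiBar q n) := hbij
  exact ⟨QuantumSL2.phiBar_mk_apply_mk q n, QuantumSL2.map_antipode _, hphi.2, hphi,
    { toIsHopfDuality := QuantumSL2.isHopfDuality_pairing q n
      injective_left := hbij.1
      injective_right := hflip }⟩
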